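/- Let $(\mathscr{M},\otimes,I)$ be a monoidal category and let $X$ be a nonempty set. Let $\overline{X}$ be the coarse category of $X$: its objects are the elements of $X$, and there is exactly one arrow $(A,B)$ from $A$ to $B$ for all $A,B\in X$. Let $\mathscr{P}_{\overline{X}}$ be the $2$-path-category of $\overline{X}$: the strict $2$-category whose objects are the elements of $X$; whose $1$-cells $A\to B$ are the chains $[n,s]$ of $n\ge 0$ composable arrows of $\overline{X}$ from $A$ to $B$ (for $n=0$ there is only $[0,A]$, which requires $A=B$), composed by concatenation, $t\otimes s$ being $s$ followed by $t$; and whose $2$-cells $[n,s]\to[m,t]$ are the nondecreasing maps $u:\{0,\dots,n-1\}\to\{0,\dots,m-1\}$ such that replacing the consecutive arrows of $s$ with indices in $u^{-1}(j)$ by their composite (an identity if $u^{-1}(j)$ is empty), for $j=0,\dots,m-1$, gives $t$; vertical composition of $2$-cells is composition of maps, horizontal composition is ordinal sum. Regard $\mathscr{M}$ as a bicategory with one object, in which the composite of $f$ followed by $g$ is $g\otimes f$. An $\overline{X}$-point of $(\mathscr{M},\mathrm{Iso}(\mathscr{M}))$ is a colax morphism of bicategories $F=(F,\varphi):\mathscr{P}_{\overline{X}}\to\mathscr{M}$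 all of whose colaxity maps $$\varphi(A,B,C)(t,s): F(t\otimes s)\to F(t)\otimes F(s),\qquad \varphi_A: F([0,A])\to I$$ are invertible. A morphism of points $F\to G$ is a transformation whose $1$-cell components are identities, that is, a family of maps $\sigma_s: F(s)\to G(s)$, natural in $s$ and compatible with the colaxity maps of $F$ and $G$. For every $\overline{X}$-point $F$ of $(\mathscr{M},\mathrm{Iso}(\mathscr{M}))$, the following data form a category $\mathscr{M}^X_F$ enriched over $\mathscr{M}$ with set of objects $X$: the hom-objects $\mathscr{M}^X_F(A,B)=F([1,(A,B)])$, the unit maps $$I\xrightarrow{\varphi_A^{-1}}F([0,A])\xrightarrow{F(0\to 1)}F([1,(A,A)]),$$ and the composition maps $$F([1,(B,C)])\otimes F([1,(A,B)])\xrightarrow{\varphi^{-1}}F([2,(A,B,C)])\xrightarrow{F(2\to 1)}F([1,(A,C)]).$$ Moreover $F\mapsto\mathscr{M}^X_F$, $\sigma\mapsto(\sigma_{[1,(A,B)]})_{A,B}$ is an equivalence from the category of $\overline{X}$-points of $(\mathscr{M},\mathrm{Iso}(\mathscr{M}))$ to the category of categories enriched over $\mathscr{M}$ with set of objects $X$ and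 enriched functors that are the identity on objects. In particular every category enriched over $\mathscr{M}$ with set of objects $X$ is isomorphic, by an isomorphism that is the identity on objects, to $\mathscr{M}^X_F$ for some $\overline{X}$-point $F$, and $F$ is unique up to isomorphism. -/

import Mathlib

open CategoryTheory MonoidalCategory

universe w w' v u

/-! ### Chains of composable arrows -/

/-- A chain `A = A₀ ⟶ A₁ ⟶ ⋯ ⟶ Aₙ = B` of composable arrows of `C`; the chain of length `0`
exists only when the two ends are equal. -/
inductive Chain {C : Type u} [Category.{v} C] : C → C → Type (max u v)
  | nil (A : C) : Chain A A
  | cons {A B D : C} (f : A ⟶ B) (s : Chain B D) : Chain A D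

namespace Chain

variable {C : Type u} [Category.{v} C]

/-- The number of arrows of a chain. -/
def length : {A B : C} → Chain A B → ℕ
  | _, _, nil _ => 0
  | _, _, cons _ s => length s + 1

/-- Concatenation: first the chain `s`, then the chain `t`. -/
def append : {A B D : C} → Chain A B → Chain B D → Chain A D
  | _, _, _, nil _, t => t
  | _, _, _, cons f s, t => cons f (append s t)

/-- The chain of length one given by an arrow. -/
def single {A B : C} (f : A ⟶ B) : Chain A B := cons f (nil B)

/-- The vertices `A₀, A₁, …, Aₙ, Aₙ, Aₙ, …` of a chain. -/
def vert : {A B : C} → Chain A B → ℕ → C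
  | A, _, _, 0 => A
  | A, _, nil _, _ + 1 => A
  | _, _, cons _ s, k + 1 => vert s k
termination_by structural _ _ _ k => k

/-- The arrows of a chain, continued by identities of its end. -/
def step : {A B : C} → (s : Chain A B) → (k : ℕ) → (vert s k ⟶ vert s (k + 1))
  | A, _, nil _, 0 => 𝟙 A
  | A, _, nil _, _ + 1 => 𝟙 A
  | _, _, cons f _, 0 => f
  | _, _, cons _ s, k + 1 => step s k
termination_by structural _ _ _ k => k

/-- A chain of length `n` as an `n`-simplex `0 ↦ A₀, …, n ↦ Aₙ` of the nerve of `C`, continued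
constantly beyond `n`: it sends `i ≤ j` to the composite of the arrows from `Aᵢ` to `Aⱼ`. -/
def simplex {A B : C} (s : Chain A B) : ℕ ⥤ C := Functor.ofSequence (step s)

@[simp] lemma length_nil (A : C) : (nil A).length = 0 := rfl
@[simp] lemma length_cons {A B D : C} (f : A ⟶ B) (s : Chain B D) :
    (cons f s).length = s.length + 1 := rfl
@[simp] lemma nil_append {A B : C} (s : Chain A B) : (nil A).append s = s := rfl
@[simp] lemma cons_append {A B D E : C} (f : A ⟶ B) (s : Chain B D) (t : Chain D E) :
    (cons f s).append t = cons f (s.append t) := rfl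

@[simp] lemma length_single {A B : C} (f : A ⟶ B) : (single f).length = 1 := rfl

@[simp] lemma length_append {A B D : C} (s : Chain A B) (t : Chain B D) :
    (s.append t).length = s.length + t.length := by
  induction s with
  | nil => simp
  | cons f s ih => simp [ih]; omega

lemma append_assoc {A B D E : C} (s : Chain A B) (t : Chain B D) (r : Chain D E) :
    (s.append t).append r = s.append (t.append r) := by
  induction s with
  | nil => rfl
  | cons f s ih => simp [ih]

@[simp] lemma append_nil {A B : C} (s : Chain A B) : s.append (nil B) = s := by
  induction s with
  | nil => rfl
  | cons f s ih => simp [ih]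

/-- The composite of the arrows between the vertices number `i` and `j`, with its source and
target. -/
def seg {A B : C} (s : Chain A B) (i j : ℕ) (h : i ≤ j) : Arrow C :=
  Arrow.mk (s.simplex.map (homOfLE h))

lemma seg_cons {A B D : C} (f : A ⟶ B) (s : Chain B D) (i j : ℕ) (h : i ≤ j) :
    (cons f s).seg (i + 1) (j + 1) (by omega) = s.seg i j h := rfl

lemma seg_self {A B : C} (s : Chain A B) (i : ℕ) : s.seg i i le_rfl = Arrow.mk (𝟙 (s.vert i)) := by
  have : s.simplex.map (homOfLE (le_refl i)) = 𝟙 _ := s.simplex.map_id i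
  rw [seg, this]; rfl

lemma seg_zero {A B : C} (s : Chain A B) : s.seg 0 0 le_rfl = Arrow.mk (𝟙 A) := seg_self s 0

lemma seg_cons_zero {A B D : C} (f : A ⟶ B) (s : Chain B D) (j : ℕ) :
    (cons f s).seg 0 (j + 1) (by omega) = Arrow.mk (f ≫ s.simplex.map (homOfLE (Nat.zero_le j))) := by
  have h : (cons f s).simplex.map (homOfLE (Nat.zero_le (j + 1)))
      = (cons f s).simplex.map (homOfLE (Nat.zero_le 1))
        ≫ (cons f s).simplex.map (homOfLE (by omega : 1 ≤ j + 1)) := by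
    rw [← Functor.map_comp]; rfl
  rw [seg, h]
  rfl

lemma seg_nil (A : C) (i j : ℕ) (h : i ≤ j) : (nil A).seg i j h = Arrow.mk (𝟙 A) := by
  have hv : ∀ k, (nil A).vert k = A := fun k => by cases k <;> rfl
  have hs : ∀ k, Arrow.mk ((nil A).step k) = Arrow.mk (𝟙 A) := fun k => by cases k <;> rfl
  induction j, h using Nat.le_induction with
  | base =>
    rw [seg_self]
    cases i <;> rfl
  | succ j h ih =>
    have e : (nil A).simplex.map (homOfLE (show i ≤ j + 1 by omega))
        = (nil A).simplex.map (homOfLE h) ≫ (nil A).simplex.map (homOfLE (Nat.le_succ j)) := by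
      rw [← Functor.map_comp]; rfl
    have e2 : (nil A).simplex.map (homOfLE (Nat.le_succ j)) = (nil A).step j :=
      Functor.ofSequence_map_homOfLE_succ _ _
    rw [seg, e, e2]
    cases j with
    | zero => exact (congrArg Arrow.mk (Category.comp_id _)).trans ih
    | succ j => exact (congrArg Arrow.mk (Category.comp_id _)).trans ih

/-- Two `ℕ`-sequences of composable arrows agree when their consecutive arrows agree. -/
lemma natFunctor_ext {F G : ℕ ⥤ C}
    (h : ∀ k : ℕ, Arrow.mk (F.map (homOfLE (Nat.le_succ k)))
      = Arrow.mk (G.map (homOfLE (Nat.le_succ k)))) : F = G := by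
  have h0 : ∀ k, F.obj k = G.obj k := fun k => congrArg (fun a : Arrow C => a.left) (h k)
  refine Functor.hext h0 ?_
  intro i j f
  have hij := leOfHom f
  obtain rfl : f = homOfLE hij := Subsingleton.elim _ _
  induction j, hij using Nat.le_induction with
  | base =>
    have e1 : F.map (homOfLE (le_refl i)) = 𝟙 _ := F.map_id i
    have e2 : G.map (homOfLE (le_refl i)) = 𝟙 _ := G.map_id i
    rw [e1, e2, h0 i]
  | succ j hij ih =>
    have e1 : F.map (homOfLE (show i ≤ j + 1 by omega))
        = F.map (homOfLE hij) ≫ F.map (homOfLE (Nat.le_succ j)) := by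
      rw [← Functor.map_comp]; rfl
    have e2 : G.map (homOfLE (show i ≤ j + 1 by omega))
        = G.map (homOfLE hij) ≫ G.map (homOfLE (Nat.le_succ j)) := by
      rw [← Functor.map_comp]; rfl
    have hj : HEq (F.map (homOfLE (Nat.le_succ j))) (G.map (homOfLE (Nat.le_succ j))) := by
      have := h j
      rw [Arrow.mk_eq_mk_iff] at this
      obtain ⟨_, _, h3⟩ := this
      rw [h3]
      simp
    rw [e1, e2]
    have key : ∀ {a b c a' b' c' : C} (p : a ⟶ b) (q : b ⟶ c) (p' : a' ⟶ b') (q' : b' ⟶ c'),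
        a = a' → b = b' → c = c' → HEq p p' → HEq q q' → HEq (p ≫ q) (p' ≫ q') := by
      rintro a b c a' b' c' p q p' q' rfl rfl rfl h1 h2
      cases h1; cases h2; rfl
    exact key _ _ _ _ (h0 i) (h0 j) (h0 (j + 1)) ih hj

lemma seg_append_left {A B D : C} (s : Chain A B) (t : Chain B D) (i j : ℕ) (h : i ≤ j)
    (hj : j ≤ s.length) : (s.append t).seg i j h = s.seg i j h := by
  induction s generalizing i j with
  | nil =>
    obtain rfl : j = 0 := by simpa using hj
    obtain rfl : i = 0 := by omega
    rw [seg_zero, seg_zero]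
  | cons f s ih =>
    cases j with
    | zero =>
      obtain rfl : i = 0 := by omega
      rw [seg_zero, seg_zero]
    | succ j =>
      have hj' : j ≤ s.length := by simpa using hj
      cases i with
      | zero =>
        rw [cons_append, seg_cons_zero, seg_cons_zero]
        have := ih t 0 j (Nat.zero_le j) hj'
        have key : ∀ {a b c c' : C} (p : a ⟶ b) (q : b ⟶ c) (q' : b ⟶ c'),
            Arrow.mk q = Arrow.mk q' → Arrow.mk (p ≫ q) = Arrow.mk (p ≫ q') := by
          intro a b c c' p q q' h
          rw [Arrow.mk_eq_mk_iff] at h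
          obtain ⟨_, rfl, h3⟩ := h
          simp at h3
          rw [h3]
        exact key f _ _ this
      | succ i => exact ih t i j (by omega) hj'

lemma seg_append_right {A B D : C} (s : Chain A B) (t : Chain B D) (i j : ℕ) (h : i ≤ j) :
    (s.append t).seg (s.length + i) (s.length + j) (by omega) = t.seg i j h := by
  induction s with
  | nil => simp
  | cons f s ih =>
    have := ih t
    rw [← this]
    simp only [cons_append, length_cons, Nat.add_right_comm _ 1]
    rfl

end Chain

/-! ### Morphisms of chains -/

/-- The number of elements that a nondecreasing map `u : n → m` sends below `k`: if `u` groups `n`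
consecutive arrows into `m` blocks, this is the number of arrows in the first `k` blocks. -/
def cut {n m : ℕ} (u : Fin n →o Fin m) (k : ℕ) : ℕ :=
  (Finset.univ.filter fun i : Fin n => (u i : ℕ) < k).card

lemma cut_mono {n m : ℕ} (u : Fin n →o Fin m) : Monotone (cut u) := by
  intro k l h
  apply Finset.card_le_card
  intro i
  simp only [Finset.mem_filter, Finset.mem_univ, true_and]
  omega

lemma cut_le {n m : ℕ} (u : Fin n →o Fin m) (k : ℕ) : cut u k ≤ n := by
  exact (Finset.card_le_univ _).trans (by simp)

lemma lt_cut {n m : ℕ} (u : Fin n →o Fin m) (k : ℕ) (i : Fin n) :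
    (i : ℕ) < cut u k ↔ (u i : ℕ) < k := by
  constructor
  · intro h
    by_contra hc
    have : cut u k ≤ (Finset.Iio i).card := by
      apply Finset.card_le_card
      intro j
      simp only [Finset.mem_filter, Finset.mem_univ, true_and, Finset.mem_Iio]
      intro hj
      by_contra hij
      have : u i ≤ u j := u.monotone (not_lt.1 hij)
      have : (u i : ℕ) ≤ u j := this
      omega
    rw [Fin.card_Iio] at this
    omega
  · intro h
    have : (Finset.Iic i).card ≤ cut u k := by
      apply Finset.card_le_card
      intro j
      simp only [Finset.mem_filter, Finset.mem_univ, true_and, Finset.mem_Iic]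
      intro hj
      have : (u j : ℕ) ≤ u i := u.monotone hj
      omega
    rw [Fin.card_Iic] at this
    omega

lemma cut_eq {n m : ℕ} (u : Fin n →o Fin m) (k c : ℕ) (hc : c ≤ n)
    (h : ∀ i : Fin n, (i : ℕ) < c ↔ (u i : ℕ) < k) : cut u k = c := by
  have h1 := cut_le u k
  rcases lt_trichotomy (cut u k) c with h2 | h2 | h2
  · have h3 := lt_cut u k ⟨cut u k, by omega⟩
    have h4 := h ⟨cut u k, by omega⟩
    simp only at h3 h4
    omega
  · exact h2
  · have h3 := lt_cut u k ⟨c, by omega⟩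
    have h4 := h ⟨c, by omega⟩
    simp only at h3 h4
    omega

/-- A morphism from the chain `s`, of length `n`, to the chain `t`, of length `m`: a nondecreasing
map `u : n → m` such that replacing the consecutive arrows of `s` in each block `u ⁻¹ {j}` by their
composite (an identity, if the block is empty) gives the chain `t`. In terms of simplices, `t` is
`s` precomposed with `cut u`: the vertex number `k` of `t` is the vertex number `cut u k` of `s`,
and the arrow number `k` of `t` is the composite of the arrows of `s` between the vertices
`cut u k` and `cut u (k + 1)`. -/
@[ext]
structure Chain.Cell {C : Type u} [Category.{v} C] {A B : C} (s t : Chain A B) : Type where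
  /-- the underlying morphism of finite ordinals -/
  map : Fin s.length →o Fin t.length
  /-- the blocks compose to the arrows of the target -/
  simplex_eq : (cut_mono map).functor ⋙ s.simplex = t.simplex

namespace Chain

variable {C : Type u} [Category.{v} C]

lemma Cell.seg_eq {A B : C} {s t : Chain A B} (u : Cell s t) (i j : ℕ) (h : i ≤ j) :
    s.seg (cut u.map i) (cut u.map j) (cut_mono u.map h) = t.seg i j h := by
  have key : ∀ F G : ℕ ⥤ C, F = G →
      Arrow.mk (F.map (homOfLE h)) = Arrow.mk (G.map (homOfLE h)) := by
    rintro F _ rfl; rfl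
  exact key _ _ u.simplex_eq

lemma simplex_eq_of_seg {A B : C} {s t : Chain A B} (u : Fin s.length →o Fin t.length)
    (h : ∀ k : ℕ, s.seg (cut u k) (cut u (k + 1)) (cut_mono u k.le_succ)
      = t.seg k (k + 1) k.le_succ) :
    (cut_mono u).functor ⋙ s.simplex = t.simplex :=
  natFunctor_ext h

lemma seg_congr {A B : C} (s : Chain A B) {i j i' j' : ℕ} (h : i ≤ j) (h' : i' ≤ j')
    (hi : i = i') (hj : j = j') : s.seg i j h = s.seg i' j' h' := by
  subst hi hj; rfl

lemma Cell.hext {A B : C} {s t : Chain A B} {u u' : Cell s t}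
    (h : ∀ i, (u.map i : ℕ) = u'.map i) : u = u' :=
  Cell.ext (OrderHom.ext _ _ (funext fun i => Fin.ext (h i)))

lemma seg_end {A B : C} (s : Chain A B) (i j : ℕ) (h : i ≤ j) (hi : s.length ≤ i) :
    s.seg i j h = Arrow.mk (𝟙 B) := by
  obtain ⟨i, rfl⟩ := Nat.exists_eq_add_of_le hi
  obtain ⟨j, rfl⟩ := Nat.exists_eq_add_of_le (show s.length ≤ j by omega)
  have := seg_append_right s (nil B) i j (by omega)
  rw [seg_nil] at this
  rw [← this]
  congr 1
  simp

/-- The morphism between equal chains given by the identity of `Δ`. -/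
def Cell.ofEq {A B : C} {s t : Chain A B} (h : s = t) : Cell s t where
  map := ⟨fun i => ⟨i, h ▸ i.isLt⟩, fun _ _ hij => hij⟩
  simplex_eq := by
    subst h
    apply simplex_eq_of_seg
    set u : Fin s.length →o Fin s.length := ⟨fun i => ⟨i, i.isLt⟩, fun _ _ hij => hij⟩ with hu
    have hv : ∀ i, (u i : ℕ) = i := fun i => rfl
    intro k
    by_cases hk : k + 1 ≤ s.length
    · exact seg_congr _ _ _ (cut_eq _ _ _ (by omega) fun i => by rw [hv])
        (cut_eq _ _ _ hk fun i => by rw [hv])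
    · have h1 : cut u k = s.length :=
        cut_eq _ _ _ le_rfl fun i => by rw [hv]; omega
      rw [seg_end _ _ _ _ h1.ge, seg_end _ _ _ _ (by omega)]

/-- Vertical composition, given by the composition of `Δ`. -/
def Cell.comp {A B : C} {r s t : Chain A B} (u : Cell r s) (v : Cell s t) : Cell r t where
  map := v.map.comp u.map
  simplex_eq := by
    apply simplex_eq_of_seg
    have hc : ∀ k, cut (v.map.comp u.map) k = cut u.map (cut v.map k) := fun k =>
      cut_eq _ _ _ (cut_le _ _) fun i => by
        rw [lt_cut, lt_cut]; rfl
    intro k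
    rw [← v.seg_eq, ← u.seg_eq]
    exact seg_congr _ _ _ (hc _) (hc _)

instance (A B : C) : Category (Chain A B) where
  Hom := Cell
  id s := Cell.ofEq rfl
  comp u v := u.comp v

/-- The ordinal sum `u + v` of two nondecreasing maps, `u` acting on the first summand. -/
def ordinalSum {A B D : C} {s s' : Chain A B} {t t' : Chain B D}
    (u : Fin s.length →o Fin s'.length) (v : Fin t.length →o Fin t'.length) :
    Fin (s.append t).length →o Fin (s'.append t').length where
  toFun i :=
    if h : (i : ℕ) < s.length then
      ⟨u ⟨i, h⟩, by
        have := (u ⟨i, h⟩).isLt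
        have := length_append s' t'
        omega⟩
    else
      ⟨s'.length + v ⟨i - s.length, by have := i.isLt; have := length_append s t; omega⟩, by
        have := length_append s' t'
        omega⟩
  monotone' := by
    intro i j hij
    have hij' : (i : ℕ) ≤ j := hij
    rw [Fin.le_def]
    by_cases h : (i : ℕ) < s.length <;> by_cases h' : (j : ℕ) < s.length
    · simp only [h, h', dif_pos]
      exact u.monotone hij'
    · simp only [h, h', dif_pos, dif_neg, not_false_iff]
      omega
    · omega
    · simp only [h, h', dif_neg, not_false_iff]
      refine Nat.add_le_add_left (v.monotone ?_) _
      rw [Fin.le_def]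
      simp only
      omega

lemma ordinalSum_left {A B D : C} {s s' : Chain A B} {t t' : Chain B D}
    (u : Fin s.length →o Fin s'.length) (v : Fin t.length →o Fin t'.length)
    (i : Fin (s.append t).length) (h : (i : ℕ) < s.length) :
    (ordinalSum u v i : ℕ) = u ⟨i, h⟩ := by
  change ((dite _ _ _ : Fin _) : ℕ) = _
  rw [dif_pos h]

lemma ordinalSum_right {A B D : C} {s s' : Chain A B} {t t' : Chain B D}
    (u : Fin s.length →o Fin s'.length) (v : Fin t.length →o Fin t'.length)
    (i : Fin (s.append t).length) (h : ¬ (i : ℕ) < s.length) :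
    (ordinalSum u v i : ℕ) = s'.length
      + v ⟨i - s.length, by have := i.isLt; have := length_append s t; omega⟩ := by
  change ((dite _ _ _ : Fin _) : ℕ) = _
  rw [dif_neg h]

/-- Concatenation of morphisms of chains, given by the ordinal sum. -/
def Cell.append {A B D : C} {s s' : Chain A B} {t t' : Chain B D} (u : Cell s s')
    (v : Cell t t') : Cell (s.append t) (s'.append t') where
  map := ordinalSum u.map v.map
  simplex_eq := by
    apply simplex_eq_of_seg
    have h1 : ∀ k, k ≤ s'.length → cut (ordinalSum u.map v.map) k = cut u.map k := by
      intro k hk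
      have hu := cut_le u.map k
      refine cut_eq _ _ _ (by rw [length_append]; omega) fun i => ?_
      by_cases h : (i : ℕ) < s.length
      · rw [ordinalSum_left _ _ _ h, ← lt_cut]
      · rw [ordinalSum_right _ _ _ h]
        omega
    have h2 : ∀ k, cut (ordinalSum u.map v.map) (s'.length + k) = s.length + cut v.map k := by
      intro k
      have hv := cut_le v.map k
      refine cut_eq _ _ _ (by rw [length_append]; omega) fun i => ?_
      by_cases h : (i : ℕ) < s.length
      · rw [ordinalSum_left _ _ _ h]
        have := (u.map ⟨i, h⟩).isLt
        omega
      · rw [ordinalSum_right _ _ _ h]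
        have := lt_cut v.map k
          ⟨i - s.length, by have := i.isLt; have := length_append s t; omega⟩
        simp only at this
        omega
    intro k
    by_cases hk : k + 1 ≤ s'.length
    · rw [seg_append_left _ _ _ _ _ hk, ← u.seg_eq, ← seg_append_left s t _ _ _ (cut_le _ _)]
      exact seg_congr _ _ _ (h1 _ (by omega)) (h1 _ hk)
    · obtain ⟨k, rfl⟩ := Nat.exists_eq_add_of_le (show s'.length ≤ k by omega)
      have e : (s'.append t').seg (s'.length + k) (s'.length + k + 1) (Nat.le_succ _)
          = t'.seg k (k + 1) k.le_succ := seg_append_right s' t' k (k + 1) k.le_succ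
      rw [e, ← v.seg_eq, ← seg_append_right s t]
      exact seg_congr _ _ _ (h2 _) (h2 (k + 1))

/-- The map of a morphism of chains, continued by a translation beyond the length. -/
def Cell.val {A B : C} {s t : Chain A B} (u : Cell s t) (i : ℕ) : ℕ :=
  if h : i < s.length then u.map ⟨i, h⟩ else t.length + (i - s.length)

lemma Cell.val_lt {A B : C} {s t : Chain A B} (u : Cell s t) {i : ℕ} (h : i < s.length) :
    u.val i < t.length := by
  rw [val, dif_pos h]
  exact (u.map ⟨i, h⟩).isLt

lemma Cell.val_of_le {A B : C} {s t : Chain A B} (u : Cell s t) {i : ℕ} (h : s.length ≤ i) :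
    u.val i = t.length + (i - s.length) := by
  rw [val, dif_neg (not_lt.2 h)]

lemma Cell.val_ext {A B : C} {s t : Chain A B} {u u' : Cell s t}
    (h : ∀ i, u.val i = u'.val i) : u = u' := by
  apply Cell.hext
  intro i
  have := h i
  rwa [val, val, dif_pos i.isLt, dif_pos i.isLt] at this

@[simp] lemma Cell.val_ofEq {A B : C} {s t : Chain A B} (h : s = t) (i : ℕ) :
    (Cell.ofEq h).val i = i := by
  subst h
  unfold val
  split
  · rfl
  · omega

@[simp] lemma Cell.val_id {A B : C} (s : Chain A B) (i : ℕ) :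
    Cell.val (𝟙 s) i = i := Cell.val_ofEq rfl i

@[simp] lemma Cell.val_comp {A B : C} {r s t : Chain A B} (u : r ⟶ s) (v : s ⟶ t) (i : ℕ) :
    Cell.val (u ≫ v) i = Cell.val v (Cell.val u i) := by
  by_cases h : i < r.length
  · have h' := Cell.val_lt u h
    have e : Cell.val u i = u.map ⟨i, h⟩ := dif_pos h
    rw [val, dif_pos h, val, dif_pos h']
    simp only [e]
    rfl
  · have e := Cell.val_of_le u (not_lt.1 h)
    rw [Cell.val_of_le _ (not_lt.1 h), Cell.val_of_le v (by omega), e]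
    omega

@[simp] lemma Cell.val_append {A B D : C} {s s' : Chain A B} {t t' : Chain B D} (u : Cell s s')
    (v : Cell t t') (i : ℕ) :
    (u.append v).val i = if i < s.length then u.val i else s'.length + v.val (i - s.length) := by
  have l := length_append s t
  have l' := length_append s' t'
  by_cases h : i < s.length
  · rw [if_pos h, val, dif_pos (by omega), val, dif_pos h]
    exact ordinalSum_left u.map v.map _ h
  · rw [if_neg h]
    by_cases h' : i < (s.append t).length
    · rw [val, dif_pos h', val, dif_pos (by omega)]
      exact ordinalSum_right u.map v.map _ h
    · rw [Cell.val_of_le _ (by omega), Cell.val_of_le _ (by omega)]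
      omega

/-- The morphism from a chain of two arrows to the chain given by their composite, over the
unique map `2 → 1`. -/
def collapse {A B D : C} (f : A ⟶ B) (g : B ⟶ D) (k : A ⟶ D) (h : f ≫ g = k) :
    (single f).append (single g) ⟶ single k where
  map := ⟨fun _ => ⟨0, by simp⟩, fun _ _ _ => le_rfl⟩
  simplex_eq := by
    subst h
    apply simplex_eq_of_seg
    intro k
    set u : Fin ((single f).append (single g)).length →o Fin (single (f ≫ g)).length :=
      ⟨fun _ => ⟨0, by simp⟩, fun _ _ _ => le_rfl⟩ with hu
    have hv : ∀ i, (u i : ℕ) = 0 := fun i => rfl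
    have h0 : cut u 0 = 0 := cut_eq _ _ _ (by omega) fun i => by rw [hv]; omega
    have h1 : ∀ l, cut u (l + 1) = 2 := fun l => cut_eq _ _ _ (by simp) fun i => by
      have := i.isLt
      simp at this
      rw [hv]; omega
    cases k with
    | zero =>
      rw [seg_congr _ _ (Nat.zero_le 2) h0 (h1 0)]
      rfl
    | succ k =>
      rw [seg_end (single (f ≫ g)) _ _ _ (by simp), seg_end _ _ _ _ (by rw [h1]; simp)]

/-- The morphism from the empty chain to the chain given by an identity, over the unique map
`0 → 1`. -/
def insertId {A : C} (k : A ⟶ A) (h : 𝟙 A = k) : nil A ⟶ single k where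
  map := ⟨fun i => absurd i.isLt (by simp), fun i _ _ => absurd i.isLt (by simp)⟩
  simplex_eq := by
    subst h
    apply simplex_eq_of_seg
    intro k
    rw [seg_nil]
    cases k with
    | zero => rfl
    | succ k => rw [seg_end _ _ _ _ (by simp)]

end Chain

/-! ### The 2-path-category -/

/-- The objects of the 2-path-category of `C`: the objects of `C`. -/
structure PathCat (C : Type u) where
  /-- the underlying object -/
  as : C

open Chain in
/-- The 2-path-category of `C`: the 1-cells are the chains of composable arrows, composed by
concatenation, the 2-cells are the morphisms of chains; the associativity and unit constraints are
identities. -/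
instance (C : Type u) [Category.{v} C] : Bicategory (PathCat C) where
  Hom A B := Chain A.as B.as
  id A := Chain.nil A.as
  comp s t := s.append t
  homCategory _ _ := inferInstance
  whiskerLeft s _ _ v := Cell.append (Cell.ofEq (rfl : s = s)) v
  whiskerRight u t := Cell.append u (Cell.ofEq (rfl : t = t))
  associator r s t :=
    { hom := Cell.ofEq (append_assoc r s t)
      inv := Cell.ofEq (append_assoc r s t).symm
      hom_inv_id := Cell.val_ext fun i => by simp
      inv_hom_id := Cell.val_ext fun i => by simp }
  leftUnitor s :=
    { hom := Cell.ofEq (nil_append s)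
      inv := Cell.ofEq (nil_append s).symm
      hom_inv_id := Category.id_comp (𝟙 s)
      inv_hom_id := Category.id_comp (𝟙 s) }
  rightUnitor s :=
    { hom := Cell.ofEq (append_nil s)
      inv := Cell.ofEq (append_nil s).symm
      hom_inv_id := Cell.val_ext fun i => by simp
      inv_hom_id := Cell.val_ext fun i => by simp }
  whiskerLeft_id s t := Cell.val_ext fun i => by
    simp only [Cell.val_append, Cell.val_ofEq, Cell.val_id]
    split_ifs <;> omega
  whiskerLeft_comp s _ _ _ u v := Cell.val_ext fun i => by
    simp only [Cell.val_append, Cell.val_ofEq, Cell.val_comp]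
    split_ifs <;> simp
    omega
  id_whiskerLeft {_ _ s t} u := by
    have h : (Cell.append (Cell.ofEq (rfl : nil _ = nil _)) u : s ⟶ t) = u :=
      Cell.val_ext fun i => (Cell.val_append _ _ i).trans (by simp)
    exact h.trans ((Category.id_comp _).trans (Category.comp_id _)).symm
  comp_whiskerLeft r s _ _ u := Cell.val_ext fun i => by
    simp only [Cell.val_append, Cell.val_ofEq, Cell.val_comp, length_append, Nat.sub_sub]
    split_ifs <;> omega
  id_whiskerRight s t := Cell.val_ext fun i => by
    simp only [Cell.val_append, Cell.val_ofEq, Cell.val_id]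
    split_ifs <;> omega
  comp_whiskerRight {_ _ _ r s t} u v w := Cell.val_ext fun i => by
    simp only [Cell.val_append, Cell.val_ofEq, Cell.val_comp]
    by_cases h : i < r.length
    · simp [h, Cell.val_lt u h]
    · simp [h]
  whiskerRight_id {_ _ r s} u := Cell.val_ext fun i => by
    simp only [Cell.val_append, Cell.val_ofEq, Cell.val_comp]
    split_ifs with h
    · rfl
    · rw [Cell.val_of_le u (by omega)]
  whiskerRight_comp {_ _ _ _ r s} u t w := Cell.val_ext fun i => by
    simp only [Cell.val_append, Cell.val_ofEq, Cell.val_comp, length_append]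
    split_ifs <;> omega
  whisker_assoc := by
    intros
    refine Cell.val_ext fun i => ?_
    simp only [Cell.val_append, Cell.val_ofEq, Cell.val_comp, length_append]
    split_ifs <;> omega
  whisker_exchange {_ _ _ r s t w} u v := Cell.val_ext fun i => by
    simp only [Cell.val_append, Cell.val_ofEq, Cell.val_comp]
    by_cases h : i < r.length
    · simp [h, Cell.val_lt u h]
    · simp [h]
  pentagon _ _ _ _ := Cell.val_ext fun i => by
    simp only [Cell.val_append, Cell.val_ofEq, Cell.val_comp, length_append]
    split_ifs <;> omega
  triangle _ _ := Cell.val_ext fun i => by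
    simp only [Cell.val_append, Cell.val_ofEq, Cell.val_comp, length_append]
    split_ifs <;> simp_all

/-! ### Path-objects in a monoidal category -/

/-- A monoidal category `M` as a bicategory with one object. The composite of `f` followed by `g`
is the tensor product `g ⊗ f`. -/
structure OneObj (M : Type u) where

instance (M : Type u) [Category.{v} M] [MonoidalCategory M] : Bicategory (OneObj M) where
  Hom _ _ := M
  id _ := 𝟙_ M
  comp f g := MonoidalCategoryStruct.tensorObj (C := M) g f
  homCategory _ _ := inferInstanceAs (Category M)
  whiskerLeft f _ _ η := MonoidalCategoryStruct.whiskerRight (C := M) η f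
  whiskerRight η h := MonoidalCategoryStruct.whiskerLeft (C := M) h η
  associator f g h := (MonoidalCategoryStruct.associator (C := M) h g f).symm
  leftUnitor f := MonoidalCategoryStruct.rightUnitor (C := M) f
  rightUnitor f := MonoidalCategoryStruct.leftUnitor (C := M) f
  whiskerLeft_id _ _ := MonoidalCategory.id_whiskerRight (C := M) _ _
  whiskerLeft_comp _ _ _ _ _ _ := MonoidalCategory.comp_whiskerRight (C := M) _ _ _
  id_whiskerLeft _ := MonoidalCategory.whiskerRight_id (C := M) _
  comp_whiskerLeft _ _ _ _ _ := MonoidalCategory.whiskerRight_tensor (C := M) _ _ _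
  id_whiskerRight _ _ := MonoidalCategory.whiskerLeft_id (C := M) _ _
  comp_whiskerRight _ _ _ := MonoidalCategory.whiskerLeft_comp (C := M) _ _ _
  whiskerRight_id _ := MonoidalCategory.id_whiskerLeft (C := M) _
  whiskerRight_comp _ _ _ := MonoidalCategory.tensor_whiskerLeft (C := M) _ _ _
  whisker_assoc _ _ _ _ _ := MonoidalCategory.whisker_assoc_symm (C := M) _ _ _
  whisker_exchange _ _ := (MonoidalCategory.whisker_exchange (C := M) _ _).symm
  pentagon _ _ _ _ := MonoidalCategory.pentagon_inv (C := M)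
  triangle _ _ := MonoidalCategory.triangle_assoc_comp_right (C := M) _ _

section PathObjects

variable {C : Type w} [Category.{w'} C] {M : Type u} [Category.{v} M] [MonoidalCategory M]

namespace Colax

/-! The data of a colax morphism from the 2-path-category of `C` to `M`, read in `M`. -/

variable (F : OplaxFunctor (PathCat C) (OneObj M))

/-- The object `F s` of `M`. -/
def obj {A B : C} (s : Chain A B) : M :=
  F.map (X := ⟨A⟩) (Y := ⟨B⟩) s

/-- The morphism `F u` of `M`. -/
def map {A B : C} {s t : Chain A B} (u : s ⟶ t) : obj F s ⟶ obj F t :=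
  F.map₂ (a := ⟨A⟩) (b := ⟨B⟩) u

/-- The colaxity map `φ(A,B,D)(t,s) : F (t ⊗ s) ⟶ F t ⊗ F s`, where `t ⊗ s` is the chain `s`
followed by the chain `t`. -/
def colaxity {A B D : C} (s : Chain A B) (t : Chain B D) :
    obj F (s.append t) ⟶ obj F t ⊗ obj F s :=
  F.mapComp (a := ⟨A⟩) (b := ⟨B⟩) (c := ⟨D⟩) s t

/-- The colaxity map `φ_A : F [0, A] ⟶ I`. -/
def counit (A : C) : obj F (Chain.nil A) ⟶ 𝟙_ M :=
  F.mapId ⟨A⟩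

end Colax

/-- A `C`-point of `(M, W)`: a colax morphism from the 2-path-category of `C` to `M` whose
colaxity maps are in `W`. -/
structure PathPoint (C : Type w) [Category.{w'} C] {M : Type u} [Category.{v} M]
    [MonoidalCategory M] (W : MorphismProperty M) where
  /-- the colax morphism -/
  colax : OplaxFunctor (PathCat C) (OneObj M)
  colaxity_mem : ∀ {A B D : C} (s : Chain A B) (t : Chain B D), W (Colax.colaxity colax s t)
  counit_mem : ∀ A : C, W (Colax.counit colax A)

namespace PathPoint

variable {W : MorphismProperty M}

/-- A morphism of `C`-points of `(M, W)` over the identity functor of `C`: a transformation of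
colax morphisms all of whose 1-cell components are identities. After cancelling these identity
1-cells, its 2-cell components are natural maps `F s ⟶ G s` that commute with the colaxity
maps. -/
@[ext]
structure Hom (F G : PathPoint C W) where
  app : ∀ {A B : C} (s : Chain A B), Colax.obj F.colax s ⟶ Colax.obj G.colax s
  naturality : ∀ {A B : C} {s t : Chain A B} (u : s ⟶ t),
    Colax.map F.colax u ≫ app t = app s ≫ Colax.map G.colax u
  app_colaxity : ∀ {A B D : C} (s : Chain A B) (t : Chain B D),
    app (s.append t) ≫ Colax.colaxity G.colax s t
      = Colax.colaxity F.colax s t ≫ (app t ⊗ₘ app s)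
  app_counit : ∀ A : C,
    app (Chain.nil A) ≫ Colax.counit G.colax A = Colax.counit F.colax A

instance : Category (PathPoint C W) where
  Hom := Hom
  id F :=
    { app := fun _ => 𝟙 _
      naturality := by simp
      app_colaxity := by simp
      app_counit := by simp }
  comp σ τ :=
    { app := fun s => σ.app s ≫ τ.app s
      naturality := fun u => by
        rw [← Category.assoc, σ.naturality, Category.assoc, τ.naturality, Category.assoc]
      app_colaxity := fun s t => by
        rw [Category.assoc, τ.app_colaxity, ← Category.assoc, σ.app_colaxity, Category.assoc,
          MonoidalCategory.tensorHom_comp_tensorHom]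
      app_counit := fun A => by
        rw [Category.assoc, τ.app_counit, σ.app_counit] }
  id_comp σ := Hom.ext (by funext; exact Category.id_comp _)
  comp_id σ := Hom.ext (by funext; exact Category.comp_id _)
  assoc σ τ ρ := Hom.ext (by funext; exact Category.assoc _ _ _)

instance (F : PathPoint C (MorphismProperty.isomorphisms M)) {A B D : C} (s : Chain A B)
    (t : Chain B D) : IsIso (Colax.colaxity F.colax s t) :=
  F.colaxity_mem s t

instance (F : PathPoint C (MorphismProperty.isomorphisms M)) (A : C) :
    IsIso (Colax.counit F.colax A) :=
  F.counit_mem A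

end PathPoint

end PathObjects

/-! ### Enriched categories with a given set of objects -/

/-- Hom-objects, unit maps and composition maps over `M` with set of objects `X`, before the
axioms of an enriched category are imposed. -/
structure EnrichedData (M : Type u) [Category.{v} M] [MonoidalCategory M] (X : Type w) where
  /-- the hom-objects -/
  hom : X → X → M
  /-- the unit maps -/
  unit : ∀ A : X, 𝟙_ M ⟶ hom A A
  /-- the composition maps -/
  comp : ∀ A B D : X, hom B D ⊗ hom A B ⟶ hom A D

namespace EnrichedData

variable {M : Type u} [Category.{v} M] [MonoidalCategory M] {X : Type w}

/-- The data preserving maps that are the identity on objects. -/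
@[ext]
structure Hom (𝒜 ℬ : EnrichedData M X) where
  app : ∀ A B : X, 𝒜.hom A B ⟶ ℬ.hom A B
  unit_app : ∀ A : X, 𝒜.unit A ≫ app A A = ℬ.unit A
  comp_app : ∀ A B D : X, 𝒜.comp A B D ≫ app A D = (app B D ⊗ₘ app A B) ≫ ℬ.comp A B D

instance : Category (EnrichedData M X) where
  Hom := Hom
  id 𝒜 :=
    { app := fun _ _ => 𝟙 _
      unit_app := by simp
      comp_app := by simp }
  comp f g :=
    { app := fun A B => f.app A B ≫ g.app A B
      unit_app := fun A => by rw [← Category.assoc, f.unit_app, g.unit_app]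
      comp_app := fun A B D => by
        rw [← Category.assoc, f.comp_app, Category.assoc, g.comp_app, ← Category.assoc,
          MonoidalCategory.tensorHom_comp_tensorHom] }
  id_comp f := Hom.ext (by funext; exact Category.id_comp _)
  comp_id f := Hom.ext (by funext; exact Category.comp_id _)
  assoc f g h := Hom.ext (by funext; exact Category.assoc _ _ _)

end EnrichedData

/-- The associativity and unit axioms of a category enriched over `M`. -/
structure IsEnrichedCategory {M : Type u} [Category.{v} M] [MonoidalCategory M] {X : Type w}
    (𝒜 : EnrichedData M X) : Prop where
  assoc : ∀ A B D E : X,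
    𝒜.comp B D E ▷ 𝒜.hom A B ≫ 𝒜.comp A B E
      = (α_ (𝒜.hom D E) (𝒜.hom B D) (𝒜.hom A B)).hom ≫ 𝒜.hom D E ◁ 𝒜.comp A B D ≫ 𝒜.comp A D E
  unit_comp : ∀ A B : X, 𝒜.unit B ▷ 𝒜.hom A B ≫ 𝒜.comp A B B = (λ_ (𝒜.hom A B)).hom
  comp_unit : ∀ A B : X, 𝒜.hom A B ◁ 𝒜.unit A ≫ 𝒜.comp A A B = (ρ_ (𝒜.hom A B)).hom

/-- The category of the categories enriched over `M` with set of objects `X`; its morphisms are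
the enriched functors that are the identity on objects. -/
abbrev EnrichedCategoryOn (M : Type u) [Category.{v} M] [MonoidalCategory M] (X : Type w) :=
  ObjectProperty.FullSubcategory (C := EnrichedData M X) IsEnrichedCategory

/-! ### From points of the coarse category to enriched data -/

section Comparison

variable (M : Type u) [Category.{v} M] [MonoidalCategory M] (X : Type w)

/-- The points over the coarse category of `X` of `M`, with respect to the isomorphisms of `M`. -/
abbrev CoarsePoint := PathPoint (Codiscrete X) (MorphismProperty.isomorphisms M)

variable {X}

/-- The unique arrow `(A, B)` of the coarse category of `X`. -/
def coarseArrow (A B : X) : Codiscrete.mk A ⟶ Codiscrete.mk B := default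

variable {M}

/-- The hom-objects `F [1, (A, B)]`, the unit maps `I ⟶ F [0, A] ⟶ F [1, (A, A)]` and the
composition maps `F [1, (B, D)] ⊗ F [1, (A, B)] ⟶ F [2, (A, B, D)] ⟶ F [1, (A, D)]`, in which the
first arrows are the inverses of the colaxity maps. -/
noncomputable def CoarsePoint.enrichedData (F : CoarsePoint M X) : EnrichedData M X where
  hom A B := Colax.obj F.colax (Chain.single (coarseArrow A B))
  unit A := inv (Colax.counit F.colax (Codiscrete.mk A)) ≫
    Colax.map F.colax (Chain.insertId (coarseArrow A A) rfl)
  comp A B D := inv (Colax.colaxity F.colax (Chain.single (coarseArrow A B))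
      (Chain.single (coarseArrow B D))) ≫
    Colax.map F.colax (Chain.collapse (coarseArrow A B) (coarseArrow B D) (coarseArrow A D) rfl)

lemma CoarsePoint.unit_app {F G : CoarsePoint M X} (σ : F ⟶ G) (A : X) :
    (inv (Colax.counit F.colax (Codiscrete.mk A)) ≫
      Colax.map F.colax (Chain.insertId (coarseArrow A A) rfl)) ≫
        σ.app (Chain.single (coarseArrow A A))
      = inv (Colax.counit G.colax (Codiscrete.mk A)) ≫
        Colax.map G.colax (Chain.insertId (coarseArrow A A) rfl) := by
  rw [Category.assoc, IsIso.inv_comp_eq, σ.naturality, ← σ.app_counit, Category.assoc,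
    IsIso.hom_inv_id_assoc]

lemma CoarsePoint.comp_app {F G : CoarsePoint M X} (σ : F ⟶ G) (A B D : X) :
    (inv (Colax.colaxity F.colax (Chain.single (coarseArrow A B))
        (Chain.single (coarseArrow B D))) ≫
      Colax.map F.colax
        (Chain.collapse (coarseArrow A B) (coarseArrow B D) (coarseArrow A D) rfl)) ≫
        σ.app (Chain.single (coarseArrow A D))
      = (σ.app (Chain.single (coarseArrow B D)) ⊗ₘ σ.app (Chain.single (coarseArrow A B))) ≫
        inv (Colax.colaxity G.colax (Chain.single (coarseArrow A B))
          (Chain.single (coarseArrow B D))) ≫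
        Colax.map G.colax
          (Chain.collapse (coarseArrow A B) (coarseArrow B D) (coarseArrow A D) rfl) := by
  rw [Category.assoc, IsIso.inv_comp_eq, σ.naturality, ← Category.assoc (Colax.colaxity F.colax _ _),
    ← σ.app_colaxity, Category.assoc, IsIso.hom_inv_id_assoc]

variable (M X)

/-- The passage from points to enriched data, as a functor: a morphism `σ : F ⟶ G` of points is
sent to its components `F [1, (A, B)] ⟶ G [1, (A, B)]`. -/
noncomputable def toEnrichedData : CoarsePoint M X ⥤ EnrichedData M X where
  obj F := F.enrichedData
  map σ :=
    { app := fun A B => σ.app (Chain.single (coarseArrow A B))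
      unit_app := fun A => CoarsePoint.unit_app σ A
      comp_app := fun A B D => CoarsePoint.comp_app σ A B D }
  map_id _ := rfl
  map_comp _ _ := rfl

end Comparison

/-! In a point `F` the colaxity maps are invertible, so splitting off one arrow at a time identifies
`F s` with the tensor product of the values of `F` on the arrows of `s`. All the information thus
lies on one-arrow chains and in the action of the 2-cells.

The enriched axioms for `F` express that two parallel 2-cells into a one-arrow chain are equal
(`hom_single_ext`): composing three arrows in either order, or inserting an identity and composing
it away, gives one and the same 2-cell. Applying `F` and cancelling invertible splittings gives
`compHom_assoc`, `unitHom_compHom` and `compHom_unitHom`.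

Everything else rests on a normal form for 2-cells over a coarse category: each one arises in
exactly one way from the identity of an empty chain by inserting an empty first block or absorbing
one more arrow into the first block (`Build.exists_toHom`, `Build.toHom_injective`). Existence gives
full faithfulness: a morphism of points is determined by its values on single arrows (`hom_ext`),
and a family compatible with units and composition extends to all chains by recursion, its
naturality being checked on the two kinds of step.

Uniqueness gives essential surjectivity: for an enriched category `𝒜`, a chain is sent to the tensor
product of its hom-objects and a 2-cell to the map computed from its recipe. Functoriality
(`exists_build_comp`) is an induction on recipes in which associativity and the right unit law are
needed; the left unit law gives the preservation of identities (`chainMap_consHom`, `chainMap_id`).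
Compatibility with concatenation (`exists_build_append`) needs no axiom of `𝒜`. The resulting point
gives back `𝒜` up to left unitors. -/

namespace CategoryTheory.MonoidalCategory

/-! ### Coherence identities in a monoidal category. -/

variable {M : Type u} [Category.{v} M] [MonoidalCategory M]

/-- The left unit law in context: a unit inserted on the right of `T` and then composed with `H` has
no effect. -/
lemma whiskerRight_insert_unit {S T E H : M} (m : S ⟶ T) (η : 𝟙_ M ⟶ E) (c : E ⊗ H ⟶ H)
    (h : η ▷ H ≫ c = (λ_ H).hom) :
    ((ρ_ S).inv ≫ (m ⊗ₘ η)) ▷ H ≫ (α_ T E H).hom ≫ T ◁ c = m ▷ H := by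
  rw [tensorHom_def, comp_whiskerRight, comp_whiskerRight, Category.assoc, Category.assoc,
    associator_naturality_middle_assoc, ← whiskerLeft_comp, h, triangle, ← comp_whiskerRight,
    ← comp_whiskerRight, rightUnitor_naturality, Iso.inv_hom_id_assoc]

/-- The right unit law in context, for an insertion followed by an absorption. -/
lemma insert_unit_comp {R S T E G : M} (u : R ⟶ S) (v : S ⟶ T ⊗ G) (η : 𝟙_ M ⟶ E)
    (c : G ⊗ E ⟶ G) (h : G ◁ η ≫ c = (ρ_ G).hom) :
    ((ρ_ R).inv ≫ (u ⊗ₘ η)) ≫ v ▷ E ≫ (α_ T G E).hom ≫ T ◁ c = u ≫ v := by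
  rw [tensorHom_def, Category.assoc, Category.assoc, whisker_exchange_assoc,
    associator_naturality_right_assoc, ← whiskerLeft_comp, h]
  simp

/-- The associative law in context: instead of absorbing `F₂` and then `F₁` into the block `G`, one
may compose `F₂` with `F₁` beforehand and absorb the result. -/
lemma absorb_comp_absorb {R S T F F₁ F₂ G G' K : M} (u : R ⟶ S ⊗ F₂) (v : S ⟶ T ⊗ G)
    (c₁ : G ⊗ F₂ ⟶ G') (c₂ : G' ⊗ F₁ ⟶ K) (c₃ : F₂ ⊗ F₁ ⟶ F) (c₄ : G ⊗ F ⟶ K)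
    (h : c₁ ▷ F₁ ≫ c₂ = (α_ G F₂ F₁).hom ≫ G ◁ c₃ ≫ c₄) :
    (u ≫ v ▷ F₂ ≫ (α_ T G F₂).hom ≫ T ◁ c₁) ▷ F₁ ≫ (α_ T G' F₁).hom ≫ T ◁ c₂
      = (u ▷ F₁ ≫ (α_ S F₂ F₁).hom ≫ S ◁ c₃) ≫ v ▷ F ≫ (α_ T G F).hom ≫ T ◁ c₄ := by
  simp only [comp_whiskerRight, Category.assoc, associator_naturality_middle_assoc,
    ← whiskerLeft_comp, h]
  simp only [whiskerLeft_comp, pentagon_assoc, whisker_exchange_assoc,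
    associator_naturality_left_assoc, associator_naturality_right_assoc]

lemma insert_unit_split {P P' S S' T T' E : M} (b : P ⟶ P') (φ' : P' ⟶ T' ⊗ S')
    (φ : P ⟶ T ⊗ S) (v : T ⟶ T') (u : S ⟶ S') (η : 𝟙_ M ⟶ E)
    (h : b ≫ φ' = φ ≫ (v ⊗ₘ u)) :
    ((ρ_ P).inv ≫ (b ⊗ₘ η)) ≫ φ' ▷ E ≫ (α_ T' S' E).hom
      = φ ≫ (v ⊗ₘ ((ρ_ S).inv ≫ (u ⊗ₘ η))) := by
  have e : (φ ≫ (v ⊗ₘ u)) ⊗ₘ η = φ ▷ 𝟙_ M ≫ ((v ⊗ₘ u) ⊗ₘ η) := by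
    rw [← tensorHom_id, tensorHom_comp_tensorHom, Category.id_comp]
  have e' : v ⊗ₘ ((ρ_ S).inv ≫ (u ⊗ₘ η)) = T ◁ (ρ_ S).inv ≫ (v ⊗ₘ (u ⊗ₘ η)) := by
    rw [← id_tensorHom, tensorHom_comp_tensorHom, Category.id_comp]
  rw [← tensorHom_id, Category.assoc, tensorHom_comp_tensorHom_assoc, h, Category.comp_id, e, e',
    Category.assoc, associator_naturality, ← rightUnitor_inv_naturality_assoc,
    rightUnitor_tensor_inv_assoc]
  simp

lemma absorb_split {P P' S S' T T' F G K : M} (b : P ⟶ P' ⊗ G) (φ' : P' ⟶ T' ⊗ S')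
    (φ : P ⟶ T ⊗ S) (v : T ⟶ T') (u : S ⟶ S' ⊗ G) (c : G ⊗ F ⟶ K)
    (h : b ≫ φ' ▷ G ≫ (α_ T' S' G).hom = φ ≫ (v ⊗ₘ u)) :
    (b ▷ F ≫ (α_ P' G F).hom ≫ P' ◁ c) ≫ φ' ▷ K ≫ (α_ T' S' K).hom
      = (φ ▷ F ≫ (α_ T S F).hom) ≫ (v ⊗ₘ (u ▷ F ≫ (α_ S' G F).hom ≫ S' ◁ c)) := by
  have h' := congrArg (· ▷ F) h
  simp only [comp_whiskerRight] at h'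
  have e : v ⊗ₘ (u ▷ F ≫ (α_ S' G F).hom ≫ S' ◁ c)
      = (v ⊗ₘ u ▷ F) ≫ T' ◁ (α_ S' G F).hom ≫ T' ◁ S' ◁ c := by
    rw [← whiskerLeft_comp, ← id_tensorHom T', tensorHom_comp_tensorHom, Category.comp_id]
  have e' : (v ⊗ₘ u) ▷ F ≫ (α_ T' (S' ⊗ G) F).hom = (α_ T S F).hom ≫ (v ⊗ₘ u ▷ F) := by
    rw [← tensorHom_id, associator_naturality, tensorHom_id]
  simp only [e, Category.assoc]
  rw [← reassoc_of% e', ← reassoc_of% h']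
  simp only [whisker_exchange_assoc, associator_naturality_right,
    ← associator_naturality_left_assoc, pentagon_assoc]

lemma cons_assoc {P Q R S T U V F : M} (e : P ⟶ Q) (φ₁ : Q ⟶ U ⊗ R) (φ₂ : U ⟶ T ⊗ S)
    (φ₃ : P ⟶ T ⊗ V) (φ₄ : V ⟶ S ⊗ R)
    (h : e ≫ φ₁ ≫ φ₂ ▷ R = φ₃ ≫ T ◁ φ₄ ≫ (α_ T S R).inv) :
    e ▷ F ≫ (φ₁ ▷ F ≫ (α_ U R F).hom) ≫ φ₂ ▷ (R ⊗ F)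
      = (φ₃ ▷ F ≫ (α_ T V F).hom) ≫ T ◁ (φ₄ ▷ F ≫ (α_ S R F).hom) ≫
        (α_ T S (R ⊗ F)).inv := by
  have h' := congrArg (· ▷ F) h
  simp only [comp_whiskerRight] at h'
  simp only [Category.assoc, whiskerRight_tensor, Iso.hom_inv_id_assoc, reassoc_of% h']
  simp

lemma cons_leftUnitor {P S F : M} (e : P ⟶ S) (φ : P ⟶ 𝟙_ M ⊗ S) (h : e = φ ≫ (λ_ S).hom) :
    e ▷ F = (φ ▷ F ≫ (α_ (𝟙_ M) S F).hom) ≫ (λ_ (S ⊗ F)).hom := by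
  subst h
  simp

lemma comp_insert_unit {R S T E : M} (u : R ⟶ S) (v : S ⟶ T) (η : 𝟙_ M ⟶ E) :
    (ρ_ R).inv ≫ ((u ≫ v) ⊗ₘ η) = u ≫ (ρ_ S).inv ≫ (v ⊗ₘ η) := by
  simp [tensorHom_def]

lemma id_whiskerRight_comp_leftUnitor {F G K : M} (c : G ⊗ F ⟶ K) :
    (𝟙 (𝟙_ M ⊗ G) ▷ F ≫ (α_ (𝟙_ M) G F).hom ≫ 𝟙_ M ◁ c) ≫ (λ_ K).hom
      = ((ρ_ (𝟙_ M ⊗ G)).inv ▷ F ≫ (α_ (𝟙_ M ⊗ G) (𝟙_ M) F).hom) ≫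
        ((λ_ G).hom ⊗ₘ (λ_ F).hom) ≫ c := by
  simp [tensorHom_def']

end CategoryTheory.MonoidalCategory

/-! ### Elementary 2-cells between chains. -/

namespace Chain

section

variable {C : Type u} [Category.{v} C]

lemma Cell.ofEq_eq_eqToHom {A B : C} {s t : Chain A B} (h : s = t) :
    (Cell.ofEq h : s ⟶ t) = eqToHom h := by
  subst h; rfl

/-- The concatenation of morphisms of chains, as an operation on arrows. -/
def appendHom {A B D : C} {s s' : Chain A B} {t t' : Chain B D} (u : s ⟶ s') (v : t ⟶ t') :
    s.append t ⟶ s'.append t' :=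
  Cell.append u v

@[simp] lemma val_appendHom {A B D : C} {s s' : Chain A B} {t t' : Chain B D} (u : s ⟶ s')
    (v : t ⟶ t') (i : ℕ) : Cell.val (appendHom u v) i
      = if i < s.length then Cell.val u i else s'.length + Cell.val v (i - s.length) :=
  Cell.val_append u v i

lemma appendHom_comp {A B D : C} {r s t : Chain A B} {r' s' t' : Chain B D} (u : r ⟶ s)
    (v : s ⟶ t) (u' : r' ⟶ s') (v' : s' ⟶ t') :
    appendHom (u ≫ v) (u' ≫ v') = appendHom u u' ≫ appendHom v v' := Cell.val_ext fun i => by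
  simp only [val_appendHom, Cell.val_comp]
  by_cases h : i < r.length
  · simp [h, Cell.val_lt u h]
  · simp [h]

/-- Two parallel morphisms to a chain of at most one arrow are equal. -/
lemma hom_single_ext {A B : C} {s : Chain A B} {f : A ⟶ B} (u u' : s ⟶ single f) : u = u' :=
  Cell.hext fun i => by
    have h := (u.map i).isLt
    have h' := (u'.map i).isLt
    simp only [length_single] at h h'
    omega

@[simp] lemma val_insertId {A : C} (k : A ⟶ A) (h : 𝟙 A = k) (i : ℕ) :
    Cell.val (insertId k h) i = 1 + i :=
  Cell.val_of_le _ (by simp)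

lemma val_collapse {A B D : C} (f : A ⟶ B) (g : B ⟶ D) (k : A ⟶ D) (h : f ≫ g = k) (i : ℕ) :
    Cell.val (collapse f g k h) i = i - 1 := by
  by_cases hi : i < 2
  · have := Cell.val_lt (collapse f g k h) (i := i) (by simpa using hi)
    simp only [length_single] at this
    omega
  · rw [Cell.val_of_le _ (by simp [single]; omega)]
    simp [single]
    omega

/-- The concatenation of an arrow with a morphism of chains. -/
def consHom {A B D : C} (f : A ⟶ B) {s t : Chain B D} (u : s ⟶ t) : cons f s ⟶ cons f t :=
  appendHom (𝟙 (single f)) u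

/-- A morphism of chains, followed by the insertion of an identity in front. -/
def insertHom {A B : C} (k : A ⟶ A) (h : 𝟙 A = k) {s t : Chain A B} (u : s ⟶ t) :
    s ⟶ cons k t :=
  appendHom (insertId k h) u

/-- The composition of the first two arrows of a chain. -/
def mergeHom {A B D E : C} (f : A ⟶ B) (g : B ⟶ D) (k : A ⟶ D) (h : f ≫ g = k)
    (t : Chain D E) : cons f (cons g t) ⟶ cons k t :=
  appendHom (collapse f g k h) (𝟙 t)

/-- The composition of the two arrows of a chain. -/
def collapseHom {A B D : C} (f : A ⟶ B) (g : B ⟶ D) (k : A ⟶ D) (h : f ≫ g = k) :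
    cons f (single g) ⟶ single k :=
  collapse f g k h

@[simp] lemma val_consHom {A B D : C} (f : A ⟶ B) {s t : Chain B D} (u : s ⟶ t) (i : ℕ) :
    Cell.val (consHom f u) i = if i = 0 then 0 else Cell.val u (i - 1) + 1 := by
  refine (val_appendHom _ _ i).trans ?_
  simp only [length_single, Nat.lt_one_iff, Cell.val_id]
  split_ifs <;> omega

@[simp] lemma val_insertHom {A B : C} (k : A ⟶ A) (h : 𝟙 A = k) {s t : Chain A B} (u : s ⟶ t)
    (i : ℕ) : Cell.val (insertHom k h u) i = Cell.val u i + 1 := by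
  refine (val_appendHom _ _ i).trans ?_
  simp [Nat.add_comm]

@[simp] lemma val_mergeHom {A B D E : C} (f : A ⟶ B) (g : B ⟶ D) (k : A ⟶ D) (h : f ≫ g = k)
    (t : Chain D E) (i : ℕ) : Cell.val (mergeHom f g k h t) i = i - 1 := by
  refine (val_appendHom _ _ i).trans ?_
  have : ((single f).append (single g)).length = 2 := rfl
  simp only [this, val_collapse, Cell.val_id, length_single]
  split_ifs <;> omega

end

end Chain

/-! ### The axioms of a colax morphism, read in the monoidal category. -/

namespace Colax

variable {C : Type w} [Category.{w'} C] {M : Type u} [Category.{v} M] [MonoidalCategory M]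
variable (F : OplaxFunctor (PathCat C) (OneObj M))

open Chain

lemma map_id {A B : C} (s : Chain A B) : map F (𝟙 s) = 𝟙 (obj F s) :=
  F.map₂_id (a := ⟨A⟩) (b := ⟨B⟩) s

lemma map_comp {A B : C} {r s t : Chain A B} (u : r ⟶ s) (v : s ⟶ t) :
    map F (u ≫ v) = map F u ≫ map F v :=
  F.map₂_comp (a := ⟨A⟩) (b := ⟨B⟩) u v

/-- The bicategorical axioms give naturality in each variable separately; an ordinal sum is a
composite of two whiskerings. -/
lemma map_appendHom_colaxity {A B D : C} {s s' : Chain A B} {t t' : Chain B D} (u : s ⟶ s')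
    (v : t ⟶ t') :
    map F (appendHom u v) ≫ colaxity F s' t' = colaxity F s t ≫ (map F v ⊗ₘ map F u) := by
  have h1 : map F (appendHom u (𝟙 t)) ≫ colaxity F s' t
      = colaxity F s t ≫ obj F t ◁ map F u :=
    F.mapComp_naturality_left (a := ⟨A⟩) (b := ⟨B⟩) (c := ⟨D⟩) u t
  have h2 : map F (appendHom (𝟙 s') v) ≫ colaxity F s' t'
      = colaxity F s' t ≫ map F v ▷ obj F s' :=
    F.mapComp_naturality_right (a := ⟨A⟩) (b := ⟨B⟩) (c := ⟨D⟩) s' v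
  have h3 : appendHom u v = appendHom u (𝟙 t) ≫ appendHom (𝟙 s') v := by
    rw [← appendHom_comp, Category.comp_id, Category.id_comp]
  rw [h3, map_comp, Category.assoc, h2, reassoc_of% h1, tensorHom_def']

lemma colaxity_assoc {A B D E : C} (r : Chain A B) (s : Chain B D) (t : Chain D E) :
    map F (eqToHom (append_assoc r s t)) ≫ colaxity F r (s.append t) ≫
        colaxity F s t ▷ obj F r
      = colaxity F (r.append s) t ≫ obj F t ◁ colaxity F r s ≫
        (α_ (obj F t) (obj F s) (obj F r)).inv := by
  rw [← Cell.ofEq_eq_eqToHom]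
  exact F.map₂_associator (a := ⟨A⟩) (b := ⟨B⟩) (c := ⟨D⟩) (d := ⟨E⟩) r s t

lemma colaxity_nil_left {A B : C} (s : Chain A B) :
    colaxity F (nil A) s ≫ obj F s ◁ counit F A ≫ (ρ_ (obj F s)).hom = 𝟙 (obj F s) :=
  (F.map₂_leftUnitor (a := ⟨A⟩) (b := ⟨B⟩) s).symm.trans (map_id F s)

lemma colaxity_nil_right {A B : C} (s : Chain A B) :
    map F (eqToHom (append_nil s))
      = colaxity F s (nil B) ≫ counit F B ▷ obj F s ≫ (λ_ (obj F s)).hom := by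
  rw [← Cell.ofEq_eq_eqToHom]
  exact F.map₂_rightUnitor (a := ⟨A⟩) (b := ⟨B⟩) s

end Colax

/-! ### The unit and composition maps of a point and their laws. -/

namespace PathPoint

open Chain Colax

variable {C : Type w} [Category.{w'} C] {M : Type u} [Category.{v} M] [MonoidalCategory M]
variable (F : PathPoint C (MorphismProperty.isomorphisms M))

/-- The colaxity map that separates the first arrow of a chain. -/
def split {A B D : C} (f : A ⟶ B) (s : Chain B D) :
    obj F.colax (cons f s) ⟶ obj F.colax s ⊗ obj F.colax (single f) :=
  colaxity F.colax (single f) s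

instance {A B D : C} (f : A ⟶ B) (s : Chain B D) : IsIso (F.split f s) :=
  F.colaxity_mem (single f) s

/-- The unit map of an identity. -/
noncomputable def unitHom {A : C} (k : A ⟶ A) (h : 𝟙 A = k) :
    𝟙_ M ⟶ obj F.colax (single k) :=
  inv (counit F.colax A) ≫ map F.colax (insertId k h)

/-- The composition map of two arrows. -/
noncomputable def compHom {A B D : C} (f : A ⟶ B) (g : B ⟶ D) (k : A ⟶ D) (h : f ≫ g = k) :
    obj F.colax (single g) ⊗ obj F.colax (single f) ⟶ obj F.colax (single k) :=
  inv (colaxity F.colax (single f) (single g)) ≫ map F.colax (collapse f g k h)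

lemma map_consHom {A B D : C} (f : A ⟶ B) {s t : Chain B D} (u : s ⟶ t) :
    map F.colax (consHom f u) ≫ F.split f t
      = F.split f s ≫ map F.colax u ▷ obj F.colax (single f) := by
  have h := map_appendHom_colaxity F.colax (𝟙 (single f)) u
  rw [Colax.map_id, tensorHom_id] at h
  exact h

/-- The colaxity map that separates an empty chain. -/
def splitNil {A B : C} (s : Chain A B) :
    obj F.colax s ⟶ obj F.colax s ⊗ obj F.colax (nil A) :=
  colaxity F.colax (nil A) s

/-- The unit axiom leaves no freedom for the colaxity map at an empty chain, since the counit is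
invertible. -/
lemma splitNil_eq {A B : C} (s : Chain A B) :
    F.splitNil s = (ρ_ (obj F.colax s)).inv ≫ obj F.colax s ◁ inv (counit F.colax A) := by
  have h : F.splitNil s ≫ obj F.colax s ◁ counit F.colax A ≫ (ρ_ (obj F.colax s)).hom
    = 𝟙 (obj F.colax s) := colaxity_nil_left F.colax s
  rw [← Category.assoc, ← Iso.eq_comp_inv, Category.id_comp] at h
  rw [← h, Category.assoc, ← whiskerLeft_comp, IsIso.hom_inv_id, whiskerLeft_id,
    Category.comp_id]

lemma map_insertHom {A B : C} (k : A ⟶ A) (h : 𝟙 A = k) {s t : Chain A B} (u : s ⟶ t) :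
    map F.colax (insertHom k h u) ≫ F.split k t
      = (ρ_ (obj F.colax s)).inv ≫ (map F.colax u ⊗ₘ F.unitHom k h) := by
  have e : map F.colax (insertHom k h u) ≫ F.split k t
      = F.splitNil s ≫ (map F.colax u ⊗ₘ map F.colax (insertId k h)) :=
    map_appendHom_colaxity F.colax (insertId k h) u
  rw [e, splitNil_eq, unitHom, tensorHom_def', tensorHom_def']
  simp

lemma colaxity_cons {A B D E : C} (f : A ⟶ B) (s : Chain B D) (t : Chain D E) :
    colaxity F.colax (cons f s) t ≫ obj F.colax t ◁ F.split f s
      = F.split f (s.append t) ≫ colaxity F.colax s t ▷ obj F.colax (single f) ≫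
        (α_ (obj F.colax t) (obj F.colax s) (obj F.colax (single f))).hom := by
  have e := colaxity_assoc F.colax (single f) s t
  -- Both bracketings are by definition the same chain, because the first factor is a single arrow;
  -- the associator in `e` is therefore an identity and drops out.
  have e' := (Category.id_comp _).symm.trans
    ((congrArg (· ≫ _) (Colax.map_id F.colax (cons f (s.append t))).symm).trans e)
  have key : ∀ {P Q Q' R R' : M} (x : P ⟶ Q) (y : Q ⟶ R) (c : P ⟶ Q') (d : Q' ⟶ R')
      (a : R ≅ R'), x ≫ y = c ≫ d ≫ a.inv → c ≫ d = x ≫ y ≫ a.hom := by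
    intro P Q Q' R R' x y c d a h
    rw [← Category.assoc x, h, Category.assoc, Category.assoc, Iso.inv_hom_id, Category.comp_id]
  exact key _ _ _ _ _ e'

/-- By `colaxity_cons`, separating the pair `f`, `g` from `t` and then `f` from `g` amounts to
splitting off `f` and then `g`; this makes `compHom` appear. -/
lemma map_mergeHom {A B D E : C} (f : A ⟶ B) (g : B ⟶ D) (k : A ⟶ D) (h : f ≫ g = k)
    (t : Chain D E) : map F.colax (mergeHom f g k h t) ≫ F.split k t
      = F.split f (cons g t) ≫ F.split g t ▷ obj F.colax (single f) ≫
        (α_ (obj F.colax t) (obj F.colax (single g)) (obj F.colax (single f))).hom ≫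
          obj F.colax t ◁ F.compHom f g k h := by
  have e := map_appendHom_colaxity F.colax (collapse f g k h) (𝟙 t)
  have e2 := F.colaxity_cons f (single g) t
  rw [Colax.map_id, id_tensorHom] at e
  have key : ∀ {P P' Q R S T : M} (c : P ⟶ T ⊗ Q) (φ : Q ⟶ R) [IsIso φ] (m : Q ⟶ S)
      (x : P ⟶ T ⊗ S) (y₁ : P ⟶ P') (y₂ : P' ⟶ T ⊗ R), c ≫ T ◁ φ = y₁ ≫ y₂ → x = c ≫ T ◁ m →
        x = y₁ ≫ y₂ ≫ T ◁ (inv φ ≫ m) := by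
    intro P P' Q R S T c φ _ m x y₁ y₂ h₁ h₂
    rw [h₂, ← Category.assoc, ← h₁, Category.assoc, ← whiskerLeft_comp, IsIso.hom_inv_id_assoc]
  refine (key _ _ _ _ _ _ e2 e).trans ?_
  simp only [Category.assoc]
  rfl

/-- The colaxity map that separates the arrow of a chain of length one. -/
def splitSingle {A B : C} (f : A ⟶ B) :
    obj F.colax (single f) ⟶ obj F.colax (nil B) ⊗ obj F.colax (single f) :=
  F.split f (nil B)

instance {A B : C} (f : A ⟶ B) : IsIso (F.splitSingle f) :=
  F.colaxity_mem (single f) (nil B)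

lemma splitSingle_eq {A B : C} (f : A ⟶ B) :
    F.splitSingle f
      = (λ_ (obj F.colax (single f))).inv ≫ inv (counit F.colax B) ▷ obj F.colax (single f) := by
  have h : F.splitSingle f ≫ counit F.colax B ▷ obj F.colax (single f) ≫
      (λ_ (obj F.colax (single f))).hom = 𝟙 (obj F.colax (single f)) :=
    (colaxity_nil_right F.colax (single f)).symm.trans (Colax.map_id F.colax (single f))
  rw [← Category.assoc, ← Iso.eq_comp_inv, Category.id_comp] at h
  rw [← h, Category.assoc, ← comp_whiskerRight, IsIso.hom_inv_id, id_whiskerRight,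
    Category.comp_id]

lemma split_compHom {A B D : C} (f : A ⟶ B) (g : B ⟶ D) (k : A ⟶ D) (h : f ≫ g = k) :
    F.split f (single g) ≫ F.compHom f g k h = map F.colax (collapseHom f g k h) :=
  IsIso.hom_inv_id_assoc _ _

/-- Inserting an identity after `f` and composing is an endomorphism of a one-arrow chain, hence the
identity 2-cell; `F` of this equation is the unit law. -/
lemma unitHom_compHom {A B : C} (f : A ⟶ B) (k : B ⟶ B) (h : 𝟙 B = k) :
    F.unitHom k h ▷ obj F.colax (single f) ≫ F.compHom f k f (by rw [← h, Category.comp_id])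
      = (λ_ (obj F.colax (single f))).hom := by
  let u : single f ⟶ cons f (single k) := consHom f (insertId k h)
  have e : map F.colax u ≫ F.split f (single k)
      = F.splitSingle f ≫ map F.colax (insertId k h) ▷ obj F.colax (single f) :=
    F.map_consHom f (insertId k h)
  have e1 : u ≫ collapseHom f k f (by rw [← h, Category.comp_id]) = 𝟙 (single f) :=
    hom_single_ext _ _
  have e2 := congrArg (map F.colax) e1
  rw [Colax.map_comp, Colax.map_id, ← split_compHom, reassoc_of% e, splitSingle_eq,
    Category.assoc, ← comp_whiskerRight_assoc, Iso.inv_comp_eq] at e2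
  exact e2.trans (Category.comp_id _)

lemma compHom_unitHom {A B : C} (f : A ⟶ B) (k : A ⟶ A) (h : 𝟙 A = k) :
    obj F.colax (single f) ◁ F.unitHom k h ≫ F.compHom k f f (by rw [← h, Category.id_comp])
      = (ρ_ (obj F.colax (single f))).hom := by
  have e := F.map_insertHom k h (𝟙 (single f))
  have e1 : insertHom k h (𝟙 (single f)) ≫ collapseHom k f f (by rw [← h, Category.id_comp])
      = 𝟙 (single f) := hom_single_ext _ _
  have e2 := congrArg (map F.colax) e1
  rw [Colax.map_comp, Colax.map_id, ← split_compHom, reassoc_of% e, Colax.map_id, id_tensorHom,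
    Iso.inv_comp_eq] at e2
  exact e2.trans (Category.comp_id _)

lemma compHom_assoc {A B D E : C} (f : A ⟶ B) (g : B ⟶ D) (h : D ⟶ E) (fg : A ⟶ D)
    (gh : B ⟶ E) (k : A ⟶ E) (h₁ : f ≫ g = fg) (h₂ : g ≫ h = gh) (h₃ : fg ≫ h = k)
    (h₄ : f ≫ gh = k) :
    F.compHom g h gh h₂ ▷ obj F.colax (single f) ≫ F.compHom f gh k h₄
      = (α_ (obj F.colax (single h)) (obj F.colax (single g)) (obj F.colax (single f))).hom ≫
        obj F.colax (single h) ◁ F.compHom f g fg h₁ ≫ F.compHom fg h k h₃ := by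
  have e : consHom f (collapseHom g h gh h₂) ≫ collapseHom f gh k h₄
      = mergeHom f g fg h₁ (single h) ≫ collapseHom fg h k h₃ := hom_single_ext _ _
  have e1 := congrArg (map F.colax) e
  have e2 := F.map_consHom f (collapseHom g h gh h₂)
  have e3 := F.map_mergeHom f g fg h₁ (single h)
  rw [Colax.map_comp, Colax.map_comp, ← split_compHom, ← split_compHom] at e1
  have e4 := ((reassoc_of% e2) (F.compHom f gh k h₄)).symm.trans e1
  rw [reassoc_of% e3, ← split_compHom, comp_whiskerRight_assoc] at e4
  -- Both sides begin by splitting the chain `f`, `g`, `h` into its three arrows, and these two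
  -- splittings are invertible.
  rwa [cancel_epi, cancel_epi] at e4

end PathPoint

/-! ### Normal forms of 2-cells over a coarse category. -/

namespace Chain

section Codiscrete

variable {X : Type w}

/-- The recipes for morphisms of chains of a coarse category: a morphism is built from the
identity of an empty chain by the insertion of empty blocks and by the absorption of one more arrow
into the first block, from right to left. -/
inductive Build : ∀ {A B : Codiscrete X}, Chain A B → Chain A B → Type w
  | nil (A : Codiscrete X) : Build (nil A) (nil A)
  | insert {A B : Codiscrete X} (g : A ⟶ A) {s t : Chain A B} (u : Build s t) :
      Build s (cons g t)
  | absorb {A B D E : Codiscrete X} (f : A ⟶ B) (g : B ⟶ D) (k : A ⟶ D) {s : Chain B E}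
      {t : Chain D E} (u : Build s (cons g t)) : Build (cons f s) (cons k t)

namespace Build

/-- The morphism of chains with a given recipe. -/
def toHom : ∀ {A B : Codiscrete X} {s t : Chain A B}, Build s t → (s ⟶ t)
  | _, _, _, _, nil A => 𝟙 (Chain.nil A)
  | _, _, _, _, insert g u => insertHom g rfl u.toHom
  | _, _, _, _, @absorb _ _ _ _ _ f g k _ t u => consHom f u.toHom ≫ mergeHom f g k rfl t

/-- The number of steps of a recipe. -/
def size : ∀ {A B : Codiscrete X} {s t : Chain A B}, Build s t → ℕ
  | _, _, _, _, nil _ => 0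
  | _, _, _, _, insert _ u => u.size + 1
  | _, _, _, _, absorb _ _ _ u => u.size + 1

/-- The underlying map of a recipe. -/
def val {A B : Codiscrete X} {s t : Chain A B} (u : Build s t) (i : ℕ) : ℕ :=
  Cell.val u.toHom i

@[simp] lemma val_nil (A : Codiscrete X) (i : ℕ) : (nil A).val i = i :=
  Cell.val_id _ i

@[simp] lemma val_insert {A B : Codiscrete X} (g : A ⟶ A) {s t : Chain A B} (u : Build s t)
    (i : ℕ) : (insert g u).val i = u.val i + 1 :=
  val_insertHom _ _ _ i

@[simp] lemma val_absorb {A B D E : Codiscrete X} (f : A ⟶ B) (g : B ⟶ D) (k : A ⟶ D)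
    {s : Chain B E} {t : Chain D E} (u : Build s (cons g t)) (i : ℕ) :
    (absorb f g k u).val i = if i = 0 then 0 else u.val (i - 1) := by
  rw [val, toHom, Cell.val_comp, val_mergeHom, val_consHom]
  split_ifs
  · rfl
  · rfl

/-- The value at `0` reveals the last step: it is positive after an insertion and zero after an
absorption. The remaining values determine the rest, and the intermediate arrow of an absorption is
fixed by its ends. -/
lemma toHom_injective {A B : Codiscrete X} {s t : Chain A B} {u u' : Build s t}
    (h : ∀ i, u.val i = u'.val i) : u = u' := by
  induction u with
  | nil A => cases u'; rfl
  | insert g u ih =>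
    cases u' with
    | insert _ u' => rw [ih fun i => by simpa using h i]
    | absorb f g k u' => simpa using h 0
  | absorb f g k u ih =>
    cases u' with
    | insert _ u' => simpa using h 0
    | absorb _ g' _ u' =>
      obtain rfl : g' = g := rfl
      rw [ih fun i => by simpa using h (i + 1)]

end Build

lemma natFunctor_ext_of_codiscrete {F G : ℕ ⥤ Codiscrete X} (h : ∀ k, F.obj k = G.obj k) :
    F = G :=
  CategoryTheory.Functor.hext h fun i j _ => by
    have key : ∀ {a b a' b' : Codiscrete X} (p : a ⟶ b) (q : a' ⟶ b'), a = a' → b = b' →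
        HEq p q := by
      rintro a b _ _ p q rfl rfl; rfl
    exact key _ _ (h i) (h j)

lemma vert_cut {A B : Codiscrete X} {s t : Chain A B} (u : s ⟶ t) (k : ℕ) :
    s.vert (cut (Cell.map u) k) = t.vert k :=
  congrArg (fun F : ℕ ⥤ Codiscrete X => F.obj k) (Cell.simplex_eq u)

/-- A morphism of chains of a coarse category, from a nondecreasing map compatible with the
vertices. -/
def homMk {A B : Codiscrete X} {s t : Chain A B} (u : Fin s.length →o Fin t.length)
    (h : ∀ k, s.vert (cut u k) = t.vert k) : s ⟶ t :=
  ⟨u, natFunctor_ext_of_codiscrete h⟩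

/-- The last step is removed according to whether the first block is empty. An insertion shortens
the target and an absorption the source, so the sum of the two lengths decreases. -/
theorem Build.exists_val {A B : Codiscrete X} {s t : Chain A B} (u : s ⟶ t) :
    ∃ b : Build s t, ∀ i, b.val i = Cell.val u i := by
  obtain ⟨n, hn⟩ : ∃ n, s.length + t.length = n := ⟨_, rfl⟩
  induction n using Nat.strong_induction_on generalizing A B s t with
  | _ n ih =>
  cases t with
  | nil =>
    cases s with
    | nil => exact ⟨.nil _, fun i => by rw [val_nil, Cell.val_of_le u (by simp)]; simp⟩
    | cons f s => exact absurd (Cell.map u ⟨0, by simp⟩).isLt (by simp)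
  | @cons _ D _ g t =>
    by_cases h0 : ∀ i, 0 < (Cell.map u i : ℕ)
    -- Nothing is sent below `1`, so the first block is empty and the first arrow of the target is a
    -- loop: its end `D` is `A`.
    · have hA : s.vert (cut (Cell.map u) 1) = t.vert 0 := vert_cut u 1
      rw [cut_eq (Cell.map u) 1 0 (Nat.zero_le _) fun i => by have := h0 i; omega] at hA
      obtain rfl : A = D := hA
      have hlt : ∀ i, (Cell.map u i : ℕ) - 1 < t.length := fun i => by
        have h1 := (Cell.map u i).isLt
        have h2 := h0 i
        simp only [length_cons] at h1
        omega
      let m : Fin s.length →o Fin t.length := ⟨fun i => ⟨Cell.map u i - 1, hlt i⟩,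
        fun i j hij => Nat.sub_le_sub_right ((Cell.map u).monotone hij) 1⟩
      have hm : ∀ i, (m i : ℕ) = Cell.map u i - 1 := fun i => rfl
      have hc : ∀ k, cut m k = cut (Cell.map u) (k + 1) := fun k =>
        cut_eq _ _ _ (cut_le _ _) fun i => by
          have := h0 i
          rw [lt_cut, hm]; omega
      let u' : s ⟶ t := homMk m fun k => by
        rw [hc]; exact vert_cut u (k + 1)
      obtain ⟨b, hb⟩ := ih _ (by rw [← hn]; simp) u' rfl
      refine ⟨.insert g b, fun i => ?_⟩
      rw [val_insert, hb]
      by_cases hi : i < s.length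
      · rw [Cell.val, Cell.val, dif_pos hi, dif_pos hi]
        have := h0 ⟨i, hi⟩
        have := hm ⟨i, hi⟩
        change (m ⟨i, hi⟩ : ℕ) + 1 = _
        omega
      · rw [Cell.val_of_le _ (by omega), Cell.val_of_le _ (by omega), length_cons]
        omega
    · push Not at h0
      obtain ⟨i₀, hi₀⟩ := h0
      cases s with
      | nil => exact absurd i₀.isLt (by simp)
      | @cons _ A' _ f s =>
      have hz : (Cell.map u ⟨0, by simp⟩ : ℕ) = 0 := by
        have : Cell.map u ⟨0, by simp⟩ ≤ Cell.map u i₀ := (Cell.map u).monotone (Nat.zero_le _)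
        have : (Cell.map u ⟨0, by simp⟩ : ℕ) ≤ Cell.map u i₀ := this
        omega
      -- What remains of the first block once `f` is removed, possibly nothing, composes to the only
      -- arrow between these ends.
      let g' : A' ⟶ D := default
      let m : Fin s.length →o Fin (cons g' t).length :=
        ⟨fun i => Cell.map u i.succ, fun i j hij => (Cell.map u).monotone
          (Nat.succ_le_succ hij)⟩
      have hm : ∀ i, (m i : ℕ) = Cell.map u i.succ := fun i => rfl
      -- The extra `1` counts `f`, which lies in the first block. At `0` both cuts vanish, so that
      -- vertex is treated separately.
      have hc : ∀ k, cut (Cell.map u) (k + 1) = cut m (k + 1) + 1 := fun k =>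
        cut_eq _ _ _ (by have := cut_le m (k + 1); simpa using this) fun i => by
          obtain ⟨_ | i, hi⟩ := i
          · rw [hz]; simp
          · have h1 := lt_cut m (k + 1) ⟨i, by simpa using hi⟩
            have h2 : (m ⟨i, by simpa using hi⟩ : ℕ) = Cell.map u ⟨i + 1, hi⟩ := rfl
            rw [h2] at h1
            rw [← h1]
            exact Nat.succ_lt_succ_iff
      let u' : s ⟶ cons g' t := homMk m fun k => by
        cases k with
        | zero => rw [cut_eq m 0 0 (Nat.zero_le _) fun i => by omega]; rfl
        | succ k =>
          have := vert_cut u (k + 1)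
          rw [hc] at this
          exact this
      obtain ⟨b, hb⟩ := ih _ (by rw [← hn]; simp) u' rfl
      refine ⟨.absorb f g' g b, fun i => ?_⟩
      rw [val_absorb]
      cases i with
      | zero =>
        rw [if_pos rfl, Cell.val, dif_pos (show 0 < (cons f s).length from Nat.succ_pos _)]
        exact hz.symm
      | succ i =>
        rw [if_neg (by simp), Nat.add_sub_cancel, hb]
        by_cases hi : i < s.length
        · rw [Cell.val, Cell.val, dif_pos hi,
            dif_pos (show i + 1 < (cons f s).length from Nat.succ_lt_succ hi)]
          rfl
        · rw [Cell.val_of_le _ (by omega), Cell.val_of_le u (by rw [length_cons]; omega), length_cons,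
            length_cons, length_cons]
          omega

theorem Build.exists_toHom {A B : Codiscrete X} {s t : Chain A B} (u : s ⟶ t) :
    ∃ b : Build s t, b.toHom = u := by
  obtain ⟨b, hb⟩ := exists_val u
  exact ⟨b, Cell.val_ext hb⟩

end Codiscrete

end Chain

open Chain Colax
variable {M : Type u} [Category.{v} M] [MonoidalCategory M] {X : Type w}

/-! ### The enriched category of a point. -/

namespace CoarsePoint

variable (F : CoarsePoint M X)

lemma isEnrichedCategory : IsEnrichedCategory ((toEnrichedData M X).obj F) where
  assoc A B D E := PathPoint.compHom_assoc F (coarseArrow A B) (coarseArrow B D)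
    (coarseArrow D E) (coarseArrow A D) (coarseArrow B E) (coarseArrow A E) rfl rfl rfl rfl
  unit_comp A B := PathPoint.unitHom_compHom F (coarseArrow A B) (coarseArrow B B) rfl
  comp_unit A B := PathPoint.compHom_unitHom F (coarseArrow A B) (coarseArrow A A) rfl

end CoarsePoint

/-! ### Full faithfulness: extension from single arrows to chains. -/

namespace PathPoint

variable {C : Type w} [Category.{w'} C] {F G : PathPoint C (MorphismProperty.isomorphisms M)}

lemma app_nil (σ : F ⟶ G) (A : C) :
    σ.app (nil A) = counit F.colax A ≫ inv (counit G.colax A) := by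
  rw [IsIso.eq_comp_inv]
  exact σ.app_counit A

lemma app_cons (σ : F ⟶ G) {A B D : C} (f : A ⟶ B) (s : Chain B D) :
    σ.app (cons f s) = F.split f s ≫ (σ.app s ⊗ₘ σ.app (single f)) ≫ inv (G.split f s) := by
  rw [← Category.assoc, IsIso.eq_comp_inv]
  exact σ.app_colaxity (single f) s

/-- Compatibility with the invertible colaxity maps forces the value on an empty chain, and on a
longer chain in terms of its first arrow and its tail. -/
lemma hom_ext {σ τ : F ⟶ G} (h : ∀ {A B : C} (f : A ⟶ B), σ.app (single f) = τ.app (single f)) :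
    σ = τ := by
  have key : ∀ {A B : C} (s : Chain A B), σ.app s = τ.app s := by
    intro A B s
    induction s with
    | nil A => rw [app_nil, app_nil]
    | cons f s ih => rw [app_cons, app_cons, ih, h]
  exact Hom.ext (by funext A B s; exact key s)

/-- The extension to all chains of a family of maps defined on chains of length one. -/
noncomputable def extend
    (φ : ∀ {A B : C} (f : A ⟶ B), obj F.colax (single f) ⟶ obj G.colax (single f)) :
    ∀ {A B : C} (s : Chain A B), obj F.colax s ⟶ obj G.colax s
  | _, _, nil A => counit F.colax A ≫ inv (counit G.colax A)
  | _, _, cons f s => F.split f s ≫ (extend φ s ⊗ₘ φ f) ≫ inv (G.split f s)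

section extend

variable (φ : ∀ {A B : C} (f : A ⟶ B), obj F.colax (single f) ⟶ obj G.colax (single f))

lemma extend_nil (A : C) :
    extend φ (nil A) ≫ counit G.colax A = counit F.colax A := by
  simp [extend]

lemma extend_cons {A B D : C} (f : A ⟶ B) (s : Chain B D) :
    extend φ (cons f s) ≫ G.split f s = F.split f s ≫ (extend φ s ⊗ₘ φ f) := by
  simp [extend]

/-- The recursion sees a single arrow as that arrow followed by an empty chain; the factor of the
empty chain cancels because `splitSingle` is determined by the counit. -/
lemma extend_single {A B : C} (f : A ⟶ B) : extend φ (single f) = φ f := by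
  have h : extend φ (single f) ≫ G.splitSingle f
      = F.splitSingle f ≫ (extend φ (nil B) ⊗ₘ φ f) := extend_cons φ f (nil B)
  rw [← cancel_mono (G.splitSingle f), h, splitSingle_eq, splitSingle_eq,
    MonoidalCategory.tensorHom_def, extend, Category.assoc, ← comp_whiskerRight_assoc,
    IsIso.inv_hom_id_assoc, ← MonoidalCategory.whisker_exchange,
    leftUnitor_inv_naturality_assoc]

lemma extend_append {A B D : C} (s : Chain A B) (t : Chain B D) :
    extend φ (s.append t) ≫ colaxity G.colax s t
      = colaxity F.colax s t ≫ (extend φ t ⊗ₘ extend φ s) := by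
  induction s with
  | nil A =>
    have h : extend φ t ≫ G.splitNil t = F.splitNil t ≫ (extend φ t ⊗ₘ extend φ (nil A)) := by
      rw [splitNil_eq, splitNil_eq]
      simp only [MonoidalCategory.tensorHom_def', extend, Category.assoc,
        ← MonoidalCategory.whiskerLeft_comp_assoc, IsIso.inv_hom_id_assoc]
      rw [MonoidalCategory.whisker_exchange, rightUnitor_inv_naturality_assoc]
    exact h
  | @cons A B _ f s ih =>
    let cF : obj F.colax (cons f (s.append t)) ⟶ obj F.colax t ⊗ obj F.colax (cons f s) :=
      colaxity F.colax (cons f s) t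
    let cG : obj G.colax (cons f (s.append t)) ⟶ obj G.colax t ⊗ obj G.colax (cons f s) :=
      colaxity G.colax (cons f s) t
    have hF : cF ≫ obj F.colax t ◁ F.split f s = _ := F.colaxity_cons f s t
    have hG : cG ≫ obj G.colax t ◁ G.split f s = _ := G.colaxity_cons f s t
    have h : extend φ (cons f (s.append t)) ≫ cG = cF ≫ (extend φ t ⊗ₘ extend φ (cons f s)) := by
      rw [← cancel_mono (obj G.colax t ◁ G.split f s), Category.assoc, hG, ← Category.assoc,
        extend_cons, ← tensorHom_id, ← id_tensorHom, Category.assoc, Category.assoc,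
        tensorHom_comp_tensorHom, Category.comp_id, extend_cons,
        tensorHom_comp_tensorHom_assoc, ih, Category.comp_id]
      -- The added identity lets the tensor product factor through the splitting of `cons f s`, so
      -- that `hF` applies.
      nth_rw 2 [← Category.id_comp (extend φ t)]
      rw [← tensorHom_comp_tensorHom, id_tensorHom, reassoc_of% hF, ← associator_naturality,
        ← tensorHom_id, tensorHom_comp_tensorHom_assoc, Category.id_comp]
    exact h

lemma extend_consHom {A B D : C} (f : A ⟶ B) {s t : Chain B D} (u : s ⟶ t)
    (h : map F.colax u ≫ extend φ t = extend φ s ≫ map G.colax u) :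
    map F.colax (consHom f u) ≫ extend φ (cons f t)
      = extend φ (cons f s) ≫ map G.colax (consHom f u) := by
  rw [← cancel_mono (G.split f t), Category.assoc, extend_cons, ← Category.assoc, map_consHom,
    Category.assoc, Category.assoc, map_consHom, ← Category.assoc (extend φ _), extend_cons]
  simp only [Category.assoc, ← tensorHom_id, tensorHom_comp_tensorHom, h, Category.comp_id,
    Category.id_comp]

lemma extend_insertHom {A B : C} (k : A ⟶ A) (hk : 𝟙 A = k) {s t : Chain A B} (u : s ⟶ t)
    (hφ : F.unitHom k hk ≫ φ k = G.unitHom k hk)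
    (h : map F.colax u ≫ extend φ t = extend φ s ≫ map G.colax u) :
    map F.colax (insertHom k hk u) ≫ extend φ (cons k t)
      = extend φ s ≫ map G.colax (insertHom k hk u) := by
  rw [← cancel_mono (G.split k t), Category.assoc, extend_cons, ← Category.assoc, map_insertHom,
    Category.assoc, Category.assoc, map_insertHom, tensorHom_comp_tensorHom, h, hφ]
  simp [MonoidalCategory.tensorHom_def]

/-- After the invertible splitting of the target, the merge acts only through the composition map,
with which `φ` commutes by hypothesis. -/
lemma extend_mergeHom {A B D E : C} (f : A ⟶ B) (g : B ⟶ D) (k : A ⟶ D) (h : f ≫ g = k)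
    (t : Chain D E)
    (hφ : F.compHom f g k h ≫ φ k = (φ g ⊗ₘ φ f) ≫ G.compHom f g k h) :
    map F.colax (mergeHom f g k h t) ≫ extend φ (cons k t)
      = extend φ (cons f (cons g t)) ≫ map G.colax (mergeHom f g k h t) := by
  rw [← cancel_mono (G.split k t), Category.assoc, extend_cons, ← Category.assoc, map_mergeHom,
    Category.assoc _ _ (G.split k t), map_mergeHom, ← Category.assoc (extend φ _), extend_cons]
  simp only [Category.assoc, ← tensorHom_id, ← id_tensorHom, tensorHom_comp_tensorHom,
    tensorHom_comp_tensorHom_assoc, extend_cons, hφ, Category.comp_id, Category.id_comp]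
  have e : (F.split g t ≫ (extend φ t ⊗ₘ φ g)) ⊗ₘ φ f
      = (F.split g t ⊗ₘ 𝟙 (obj F.colax (single f))) ≫ ((extend φ t ⊗ₘ φ g) ⊗ₘ φ f) := by
    rw [tensorHom_comp_tensorHom, Category.id_comp]
  rw [e, Category.assoc, associator_naturality_assoc, tensorHom_comp_tensorHom,
    Category.comp_id]

end extend

end PathPoint

namespace CoarsePoint

variable {F G : CoarsePoint M X}

/-- The components of a morphism of enriched data, as maps defined on chains of length one. -/
def appSingle (h : F.enrichedData ⟶ G.enrichedData) {A B : Codiscrete X} (f : A ⟶ B) :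
    obj F.colax (single f) ⟶ obj G.colax (single f) :=
  h.app A.as B.as

lemma unitHom_appSingle (h : F.enrichedData ⟶ G.enrichedData) {A : Codiscrete X} (k : A ⟶ A) :
    PathPoint.unitHom F k rfl ≫ appSingle h k = PathPoint.unitHom G k rfl :=
  h.unit_app A.as

lemma compHom_appSingle (h : F.enrichedData ⟶ G.enrichedData) {A B D : Codiscrete X}
    (f : A ⟶ B) (g : B ⟶ D) (k : A ⟶ D) :
    PathPoint.compHom F f g k rfl ≫ appSingle h k
      = (appSingle h g ⊗ₘ appSingle h f) ≫ PathPoint.compHom G f g k rfl :=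
  h.comp_app A.as B.as D.as

/-- The morphism of points with given components on chains of length one. -/
noncomputable def homMk (h : F.enrichedData ⟶ G.enrichedData) : F ⟶ G where
  app s := PathPoint.extend (appSingle h) s
  naturality {A B s t} u := by
    obtain ⟨b, rfl⟩ := Build.exists_toHom u
    induction b with
    | nil A =>
      rw [Build.toHom, Colax.map_id, Colax.map_id, Category.id_comp, Category.comp_id]
    | insert g u ih => exact PathPoint.extend_insertHom _ g rfl _ (unitHom_appSingle h g) ih
    | absorb f g k u ih =>
      rw [Build.toHom, Colax.map_comp, Colax.map_comp, Category.assoc,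
        PathPoint.extend_mergeHom _ f g k rfl _ (compHom_appSingle h f g k), ← Category.assoc,
        PathPoint.extend_consHom _ f _ ih, Category.assoc]
  app_colaxity s t := PathPoint.extend_append _ s t
  app_counit A := PathPoint.extend_nil _ A

end CoarsePoint

instance : (toEnrichedData M X).Faithful where
  map_injective {F G _ _} h := PathPoint.hom_ext fun {A B} _ =>
    congrArg (fun a : F.enrichedData ⟶ G.enrichedData => a.app A.as B.as) h

instance : (toEnrichedData M X).Full where
  map_surjective h := ⟨CoarsePoint.homMk h, EnrichedData.Hom.ext (by
    funext A B; exact PathPoint.extend_single _ (coarseArrow A B))⟩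

/-! ### Essential surjectivity: the point of an enriched category. -/

namespace EnrichedData

variable (𝒜 : EnrichedData M X)

/-- The tensor product of the hom-objects along a chain. -/
def chainObj : ∀ {A B : Codiscrete X}, Chain A B → M
  | _, _, nil _ => 𝟙_ M
  | _, _, @cons _ _ A B _ _ s => chainObj s ⊗ 𝒜.hom A.as B.as

/-- The map of tensor products given by a recipe: empty blocks are filled with units, and the
hom-objects in a block are composed. -/
def buildMap : ∀ {A B : Codiscrete X} {s t : Chain A B}, Build s t →
    (𝒜.chainObj s ⟶ 𝒜.chainObj t)
  | _, _, _, _, .nil _ => 𝟙 (𝟙_ M)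
  | _, _, _, _, @Build.insert _ A _ _ s _ u =>
    (ρ_ (𝒜.chainObj s)).inv ≫ (buildMap u ⊗ₘ 𝒜.unit A.as)
  | _, _, _, _, @Build.absorb _ A B D _ _ _ _ _ t u =>
    buildMap u ▷ 𝒜.hom A.as B.as ≫
      (α_ (𝒜.chainObj t) (𝒜.hom B.as D.as) (𝒜.hom A.as B.as)).hom ≫
        𝒜.chainObj t ◁ 𝒜.comp A.as B.as D.as

/-- The map of tensor products given by a morphism of chains. -/
noncomputable def chainMap {A B : Codiscrete X} {s t : Chain A B} (u : s ⟶ t) :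
    𝒜.chainObj s ⟶ 𝒜.chainObj t :=
  𝒜.buildMap (Build.exists_toHom u).choose

/-- Uniqueness of recipes makes the choice in `chainMap` harmless. -/
lemma chainMap_toHom {A B : Codiscrete X} {s t : Chain A B} (b : Build s t) :
    𝒜.chainMap b.toHom = 𝒜.buildMap b :=
  congrArg 𝒜.buildMap (Build.toHom_injective fun i =>
    congrArg (Cell.val · i) (Build.exists_toHom b.toHom).choose_spec)

lemma chainMap_eq {A B : Codiscrete X} {s t : Chain A B} (u : s ⟶ t) (b : Build s t)
    (h : ∀ i, b.val i = Cell.val u i) : 𝒜.chainMap u = 𝒜.buildMap b := by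
  rw [← chainMap_toHom, show b.toHom = u from Cell.val_ext h]

/-- The isomorphism that separates the tensor product along the concatenation of two chains. -/
def chainSplit : ∀ {A B D : Codiscrete X} (s : Chain A B) (t : Chain B D),
    𝒜.chainObj (s.append t) ≅ 𝒜.chainObj t ⊗ 𝒜.chainObj s
  | _, _, _, nil _, t => (ρ_ (𝒜.chainObj t)).symm
  | _, _, _, @cons _ _ A B _ _ s, t =>
    whiskerRightIso (chainSplit s t) (𝒜.hom A.as B.as) ≪≫
      α_ (𝒜.chainObj t) (𝒜.chainObj s) (𝒜.hom A.as B.as)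

variable {𝒜}

lemma chainMap_consHom (h𝒜 : IsEnrichedCategory 𝒜) {A B D : Codiscrete X} (f : A ⟶ B)
    {s t : Chain B D} (u : s ⟶ t) :
    𝒜.chainMap (consHom f u) = 𝒜.chainMap u ▷ 𝒜.hom A.as B.as := by
  obtain ⟨b, rfl⟩ := Build.exists_toHom u
  -- To keep `f` as a block of its own, the recipe opens an empty block at `B` and absorbs `f` into
  -- it.
  rw [chainMap_toHom, 𝒜.chainMap_eq _ (.absorb f (default : B ⟶ B) f (.insert _ b))]
  · have h := h𝒜.unit_comp A.as B.as
    exact MonoidalCategory.whiskerRight_insert_unit _ _ _ h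
  · intro i
    rw [val_consHom, Build.val_absorb, Build.val_insert]
    rfl

/-- Composition of recipes, by the last steps of `v` and `u`: a final insertion in `v` is postponed,
an insertion met by an absorption cancels by the right unit law, and two absorptions are rearranged
by associativity. The last case changes `v` without shrinking it, whence the induction on the total
size. -/
lemma exists_build_comp (h𝒜 : IsEnrichedCategory 𝒜) {A B : Codiscrete X} {r s t : Chain A B}
    (u : Build r s)
    (v : Build s t) : ∃ b : Build r t, (∀ i, b.val i = v.val (u.val i)) ∧
      𝒜.buildMap b = 𝒜.buildMap u ≫ 𝒜.buildMap v := by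
  obtain ⟨n, hn⟩ : ∃ n, u.size + v.size = n := ⟨_, rfl⟩
  induction n using Nat.strong_induction_on generalizing A B r s t with
  | _ n ih =>
  cases v with
  | nil => exact ⟨u, fun i => by simp, (Category.comp_id _).symm⟩
  | insert g v =>
    obtain ⟨b, hb, hb'⟩ := ih _ (by rw [← hn]; simp [Build.size]) u v rfl
    refine ⟨.insert g b, fun i => by simp [hb], ?_⟩
    rw [buildMap, hb']
    exact MonoidalCategory.comp_insert_unit _ _ _
  | @absorb A A₁ D E f g k s t v =>
    cases u with
    | insert _ u =>
      obtain ⟨b, hb, hb'⟩ := ih _ (by rw [← hn]; simp [Build.size]; omega) u v rfl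
      refine ⟨b, fun i => by simp [hb], ?_⟩
      rw [hb']
      exact (MonoidalCategory.insert_unit_comp _ _ _ _ (h𝒜.comp_unit A.as D.as)).symm
    | @absorb _ A₂ _ _ f₁ f₂ _ r _ u =>
      -- With `f₁` set aside, the first block of the middle chain is `f₂`; `v` absorbs it, and `f₁`
      -- is absorbed at the end.
      obtain ⟨b, hb, hb'⟩ := ih _ (by rw [← hn]; simp [Build.size]) u
        (.absorb f₂ g (default : A₂ ⟶ D) v) rfl
      refine ⟨.absorb f₁ _ k b, fun i => ?_, ?_⟩
      · simp only [Build.val_absorb, hb]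
        split_ifs <;> simp_all
      rw [buildMap, hb']
      exact MonoidalCategory.absorb_comp_absorb _ _ _ _ _ _ (h𝒜.assoc A.as A₂.as A₁.as D.as)

lemma chainMap_comp (h𝒜 : IsEnrichedCategory 𝒜) {A B : Codiscrete X} {r s t : Chain A B} (u : r ⟶ s)
    (v : s ⟶ t) :
    𝒜.chainMap (u ≫ v) = 𝒜.chainMap u ≫ 𝒜.chainMap v := by
  obtain ⟨b, rfl⟩ := Build.exists_toHom u
  obtain ⟨b', rfl⟩ := Build.exists_toHom v
  obtain ⟨c, hc, hc'⟩ := exists_build_comp h𝒜 b b'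
  rw [chainMap_toHom, chainMap_toHom, 𝒜.chainMap_eq _ c fun i => ?_, hc']
  rw [hc, Cell.val_comp]; rfl

lemma chainMap_id (h𝒜 : IsEnrichedCategory 𝒜) {A B : Codiscrete X} (s : Chain A B) :
    𝒜.chainMap (𝟙 s) = 𝟙 (𝒜.chainObj s) := by
  induction s with
  | nil A => exact 𝒜.chainMap_toHom (.nil A)
  | @cons A B D f s ih =>
    have e : 𝟙 (cons f s) = consHom f (𝟙 s) := Cell.val_ext fun i => by
      rw [val_consHom, Cell.val_id, Cell.val_id]
      split_ifs <;> omega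
    rw [e, chainMap_consHom h𝒜, ih, id_whiskerRight]
    rfl

/-- Recipes run from right to left, so the ordinal sum is obtained by executing `u` on top of `v`
instead of on an empty chain. -/
lemma exists_build_append {A B D : Codiscrete X} {s s' : Chain A B} {t t' : Chain B D}
    (u : Build s s') (v : Build t t') : ∃ b : Build (s.append t) (s'.append t'),
      (∀ i, b.val i = if i < s.length then u.val i else s'.length + v.val (i - s.length)) ∧
      𝒜.buildMap b ≫ (𝒜.chainSplit s' t').hom
        = (𝒜.chainSplit s t).hom ≫ (𝒜.buildMap v ⊗ₘ 𝒜.buildMap u) := by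
  induction u with
  | nil A =>
    refine ⟨v, fun i => by simp, ?_⟩
    refine (rightUnitor_inv_naturality _).trans ?_
    rw [← tensorHom_id]
    rfl
  | insert g u ih =>
    obtain ⟨b, hb, hb'⟩ := ih v
    refine ⟨.insert g b, fun i => ?_, MonoidalCategory.insert_unit_split _ _ _ _ _ _ hb'⟩
    refine (Build.val_insert g b i).trans ?_
    rw [hb, Build.val_insert, length_cons]
    split_ifs <;> omega
  | absorb f g k u ih =>
    obtain ⟨b, hb, hb'⟩ := ih v
    refine ⟨.absorb f g k b, fun i => ?_, MonoidalCategory.absorb_split _ _ _ _ _ _ hb'⟩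
    refine (Build.val_absorb f g k b i).trans ?_
    cases i with
    | zero => simp
    | succ i =>
      rw [if_neg (Nat.succ_ne_zero i), Nat.add_sub_cancel]
      refine (hb i).trans ?_
      simp

lemma chainMap_appendHom {A B D : Codiscrete X} {s s' : Chain A B} {t t' : Chain B D}
    (u : s ⟶ s') (v : t ⟶ t') :
    𝒜.chainMap (appendHom u v) ≫ (𝒜.chainSplit s' t').hom
      = (𝒜.chainSplit s t).hom ≫ (𝒜.chainMap v ⊗ₘ 𝒜.chainMap u) := by
  obtain ⟨b, rfl⟩ := Build.exists_toHom u
  obtain ⟨b', rfl⟩ := Build.exists_toHom v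
  obtain ⟨c, hc, hc'⟩ := exists_build_append (𝒜 := 𝒜) b b'
  rw [chainMap_toHom, chainMap_toHom, 𝒜.chainMap_eq _ c fun i => ?_, hc']
  rw [hc, val_appendHom]
  rfl

/-- Carries the strict associativity and unit constraints through the inductions on chains below. -/
lemma chainMap_eqToHom_cons (h𝒜 : IsEnrichedCategory 𝒜) {A B D : Codiscrete X} (f : A ⟶ B)
    {s t : Chain B D} (h : s = t)
    (h' : cons f s = cons f t) :
    𝒜.chainMap (eqToHom h') = 𝒜.chainMap (eqToHom h) ▷ 𝒜.hom A.as B.as := by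
  subst h
  rw [eqToHom_refl, eqToHom_refl, chainMap_id h𝒜, chainMap_id h𝒜, id_whiskerRight]
  rfl

lemma chainSplit_assoc (h𝒜 : IsEnrichedCategory 𝒜) {A B D E : Codiscrete X} (r : Chain A B)
    (s : Chain B D)
    (t : Chain D E) :
    𝒜.chainMap (eqToHom (append_assoc r s t)) ≫ (𝒜.chainSplit r (s.append t)).hom ≫
        (𝒜.chainSplit s t).hom ▷ 𝒜.chainObj r
      = (𝒜.chainSplit (r.append s) t).hom ≫ 𝒜.chainObj t ◁ (𝒜.chainSplit r s).hom ≫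
        (α_ (𝒜.chainObj t) (𝒜.chainObj s) (𝒜.chainObj r)).inv := by
  induction r with
  | nil A =>
    have e : 𝒜.chainMap (eqToHom (append_assoc (nil A) s t)) = 𝟙 (𝒜.chainObj (s.append t)) :=
      chainMap_id h𝒜 _
    rw [e]
    refine (Category.id_comp _).trans ((rightUnitor_inv_naturality _).symm.trans ?_)
    rw [rightUnitor_tensor_inv]
    rfl
  | cons f r ih =>
    have e := chainMap_eqToHom_cons h𝒜 f (append_assoc r s t) (append_assoc (cons f r) s t)
    exact (congrArg (· ≫ _) e).trans (MonoidalCategory.cons_assoc _ _ _ _ _ (ih s))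

lemma chainSplit_nil_right (h𝒜 : IsEnrichedCategory 𝒜) {A B : Codiscrete X} (s : Chain A B) :
    𝒜.chainMap (eqToHom (append_nil s))
      = (𝒜.chainSplit s (nil B)).hom ≫ (λ_ (𝒜.chainObj s)).hom := by
  induction s with
  | nil A =>
    have e : 𝒜.chainMap (eqToHom (append_nil (nil A))) = 𝟙 (𝟙_ M) := chainMap_id h𝒜 _
    have e' : (ρ_ (𝟙_ M)).inv ≫ (λ_ (𝟙_ M)).hom = 𝟙 (𝟙_ M) := by
      rw [unitors_equal, Iso.inv_hom_id]
    exact e.trans e'.symm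
  | cons f s ih =>
    have e := chainMap_eqToHom_cons h𝒜 f (append_nil s) (append_nil (cons f s))
    exact e.trans (MonoidalCategory.cons_leftUnitor _ _ ih)

/-- The colax morphism of an enriched category, sending a chain to the tensor product of the
hom-objects along it. -/
noncomputable def toColax (h𝒜 : IsEnrichedCategory 𝒜) :
    OplaxFunctor (PathCat (Codiscrete X)) (OneObj M) where
  obj _ := ⟨⟩
  map s := 𝒜.chainObj s
  map₂ u := 𝒜.chainMap u
  map₂_id s := chainMap_id h𝒜 s
  map₂_comp u v := chainMap_comp h𝒜 u v
  mapId _ := 𝟙 (𝟙_ M)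
  mapComp s t := (𝒜.chainSplit s t).hom
  mapComp_naturality_left {_ _ _ s s'} u t := by
    have e := 𝒜.chainMap_appendHom u (𝟙 t)
    rw [chainMap_id h𝒜, id_tensorHom] at e
    exact e
  mapComp_naturality_right s _ _ v := by
    have e := 𝒜.chainMap_appendHom (𝟙 s) v
    rw [chainMap_id h𝒜, tensorHom_id] at e
    exact e
  map₂_associator r s t := by
    have e := chainSplit_assoc h𝒜 r s t
    rw [← Cell.ofEq_eq_eqToHom] at e
    exact e
  map₂_leftUnitor {A B} s := by
    have e : 𝒜.chainMap (𝟙 s) = (ρ_ (𝒜.chainObj s)).inv ≫ 𝒜.chainObj s ◁ 𝟙 (𝟙_ M) ≫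
        (ρ_ (𝒜.chainObj s)).hom := by
      rw [chainMap_id h𝒜]; simp
    exact e
  map₂_rightUnitor {A B} s := by
    have e : 𝒜.chainMap (eqToHom (append_nil s)) = (𝒜.chainSplit s (nil B.as)).hom ≫
        𝟙 (𝟙_ M) ▷ 𝒜.chainObj s ≫ (λ_ (𝒜.chainObj s)).hom := by
      rw [chainSplit_nil_right h𝒜, id_whiskerRight]
      exact congrArg (_ ≫ ·) (Category.id_comp _).symm
    rw [← Cell.ofEq_eq_eqToHom] at e
    exact e

/-- The point of an enriched category. -/
noncomputable def toPoint (h𝒜 : IsEnrichedCategory 𝒜) : CoarsePoint M X where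
  colax := toColax h𝒜
  colaxity_mem s t := inferInstanceAs (IsIso (𝒜.chainSplit s t).hom)
  counit_mem _ := inferInstanceAs (IsIso (𝟙 (𝟙_ M)))

/-- An isomorphism of enriched data, from isomorphisms of hom-objects. -/
def isoMk {𝒜 ℬ : EnrichedData M X} (e : ∀ A B, 𝒜.hom A B ≅ ℬ.hom A B)
    (unit_app : ∀ A : X, 𝒜.unit A ≫ (e A A).hom = ℬ.unit A)
    (comp_app : ∀ A B D : X, 𝒜.comp A B D ≫ (e A D).hom
      = ((e B D).hom ⊗ₘ (e A B).hom) ≫ ℬ.comp A B D) : 𝒜 ≅ ℬ where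
  hom := ⟨fun A B => (e A B).hom, unit_app, comp_app⟩
  inv := ⟨fun A B => (e A B).inv, fun A => by rw [Iso.comp_inv_eq, unit_app], fun A B D => by
    rw [Iso.comp_inv_eq, Category.assoc, comp_app, tensorHom_comp_tensorHom_assoc,
      Iso.inv_hom_id, Iso.inv_hom_id, id_tensorHom_id, Category.id_comp]⟩
  hom_inv_id := Hom.ext (by funext A B; exact (e A B).hom_inv_id)
  inv_hom_id := Hom.ext (by funext A B; exact (e A B).inv_hom_id)

lemma chainMap_insertId {A : Codiscrete X} (k : A ⟶ A) :
    𝒜.chainMap (insertId k rfl) = (ρ_ (𝟙_ M)).inv ≫ (𝟙 (𝟙_ M) ⊗ₘ 𝒜.unit A.as) :=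
  𝒜.chainMap_eq _ (.insert k (.nil A)) fun i => by
    rw [Build.val_insert, Build.val_nil, Nat.add_comm]
    exact (val_insertId k rfl i).symm

/-- The recipe absorbs `f` into the block already formed by the identity of `single g`. -/
lemma chainMap_collapseHom (h𝒜 : IsEnrichedCategory 𝒜) {A B D : Codiscrete X} (f : A ⟶ B)
    (g : B ⟶ D) (k : A ⟶ D) :
    𝒜.chainMap (collapseHom f g k rfl)
      = 𝟙 (𝟙_ M ⊗ 𝒜.hom B.as D.as) ▷ 𝒜.hom A.as B.as ≫
        (α_ (𝟙_ M) (𝒜.hom B.as D.as) (𝒜.hom A.as B.as)).hom ≫ 𝟙_ M ◁ 𝒜.comp A.as B.as D.as := by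
  obtain ⟨b, hb⟩ := Build.exists_toHom (𝟙 (single g))
  have e : 𝒜.buildMap b = 𝟙 (𝟙_ M ⊗ 𝒜.hom B.as D.as) := by
    rw [← chainMap_toHom, hb]
    exact chainMap_id h𝒜 _
  have e' : collapseHom f g k rfl = (Build.absorb f g k b).toHom := hom_single_ext _ _
  rw [e', ← e]
  exact 𝒜.chainMap_toHom (.absorb f g k b)

/-- An enriched category is isomorphic to the one defined by its point. -/
noncomputable def toPointIso (h𝒜 : IsEnrichedCategory 𝒜) : (toPoint h𝒜).enrichedData ≅ 𝒜 :=
  -- The tensor product along a single arrow starts from the unit object, so it is `𝟙_ M ⊗ 𝒜.hom A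
  -- B`.
  isoMk (fun A B => λ_ (𝒜.hom A B))
    (fun A => by
      have e : (toPoint h𝒜).enrichedData.unit A
          = (ρ_ (𝟙_ M)).inv ≫ (𝟙 (𝟙_ M) ⊗ₘ 𝒜.unit A) :=
        (IsIso.inv_comp_eq _).2 ((chainMap_insertId _).trans (Category.id_comp _).symm)
      have e' : ((ρ_ (𝟙_ M)).inv ≫ (𝟙 (𝟙_ M) ⊗ₘ 𝒜.unit A)) ≫ (λ_ (𝒜.hom A A)).hom
          = 𝒜.unit A := by
        rw [id_tensorHom, Category.assoc, leftUnitor_naturality, unitors_equal,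
          Iso.inv_hom_id_assoc]
      exact (congrArg (· ≫ (λ_ (𝒜.hom A A)).hom) e).trans e')
    (fun A B D => by
      have e := MonoidalCategory.id_whiskerRight_comp_leftUnitor (𝒜.comp A B D)
      refine (Category.assoc _ _ _).trans ((@IsIso.inv_comp_eq _ _ _ _ _ _
        ((toPoint h𝒜).colaxity_mem (single (coarseArrow A B)) (single (coarseArrow B D)))
        _ _).2 ?_)
      refine Eq.trans ?_ e
      exact congrArg (· ≫ (λ_ (𝒜.hom A D)).hom)
        (chainMap_collapseHom h𝒜 (coarseArrow A B) (coarseArrow B D) (coarseArrow A D)))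

end EnrichedData

theorem mainTheorem2 {M : Type u} [Category.{v} M] [MonoidalCategory M] {X : Type w} [Nonempty X] :
    ∃ h : ∀ F : CoarsePoint M X, IsEnrichedCategory ((toEnrichedData M X).obj F),
      (ObjectProperty.lift IsEnrichedCategory (toEnrichedData M X) h :
        CoarsePoint M X ⥤ EnrichedCategoryOn M X).IsEquivalence := by
  refine ⟨CoarsePoint.isEnrichedCategory, ?_⟩
  have : (ObjectProperty.lift IsEnrichedCategory (toEnrichedData M X)
      CoarsePoint.isEnrichedCategory).EssSurj :=
    ⟨fun 𝒜 => ⟨EnrichedData.toPoint 𝒜.property,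
      ⟨ObjectProperty.isoMk _ (EnrichedData.toPointIso 𝒜.property)⟩⟩⟩
  -- Fullness and faithfulness pass from `toEnrichedData` to its lift to the full subcategory.
  exact { }
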